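/- In Monotone Narrow Grid Tiling the input consists of integers $x,y,N\ge 1$ and a non-empty set $S_{i,j}\subseteq\{0,1\}\times[N]$ for every $(i,j)\in[x]\times[y]$. The question is whether one can choose $s_{i,j}\in S_{i,j}$ for all $(i,j)\in[x]\times[y]$ such that - if $s_{i,j}=(a,b)$ and $s_{i+1,j}=(a',b')$, then $a=a'$; - if $s_{i,j}=(a,b)$ and $s_{i,j+1}=(a',b')$, then $b\le b'$. The Exponential Time Hypothesis (ETH) states that there is $\delta>0$ such that 3-SAT with $n$ variables (the clauses of the input formula being distinct) cannot be solved in time $O(2^{\delta n})$. **Theorem.** Assume ETH. Then for every $b>0$ there exists $\varepsilon>0$ such that for every $C>0$ there is no algorithm that solves every instance $(x,y,N,\{S_{i,j}\})$ of Monotone Narrow Grid Tiling in time $C\cdot 2^{\varepsilon\cdot x\cdot y}\cdot N^{b}$. Here algorithms are deterministic multi-stack (equivalently, multi-tape) Turing machines, and time is their number of steps. -/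

import Mathlib

/-- The Turing machine `M` (a bundled multi-stack machine, with input and output over the binary
alphabet) decides the problem `P` on all instances `a : α`, given as the word `enc a`, and on the
instance `a` it halts after at most `t a` steps, with the correct one-bit answer as its output. -/
def DecidesInTime {α : Type} (enc : α → List Bool) (P : α → Prop) (t : α → ℝ)
    (M : Turing.TM2ComputableAux Bool Bool) : Prop :=
  ∀ a : α, ∃ (answer : Bool) (m : ℕ), (answer = true ↔ P a) ∧ (m : ℝ) ≤ t a ∧
    Nonempty (Turing.TM2OutputsInTime M.tm ((enc a).map M.inputAlphabet.symm)
      (some ([answer].map M.outputAlphabet.symm)) m)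

/-! ### 3-SAT and the Exponential Time Hypothesis -/

/-- A 3-CNF formula over the variables `0, …, n - 1`, with no clause listed twice. A literal
`(v, s)` is the variable `v` if `s = true` and its negation if `s = false`; a clause is a triple of
literals (shorter clauses repeat a literal). -/
structure ThreeCNF where
  n : ℕ
  clauses : List (Fin 3 → Fin n × Bool)
  nodup : clauses.Nodup

namespace ThreeCNF

/-- Some assignment makes a literal of every clause true. -/
def Satisfiable (φ : ThreeCNF) : Prop :=
  ∃ A : Fin φ.n → Bool, ∀ c ∈ φ.clauses, ∃ k : Fin 3, A (c k).1 = (c k).2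

/-- A literal: the index of the variable in unary, a delimiter, the sign. -/
def encodeLiteral {n : ℕ} (l : Fin n × Bool) : List Bool :=
  List.replicate (l.1 : ℕ) true ++ [false, l.2]

/-- The number of variables in unary, a delimiter, the literals of all clauses in order. -/
def encode (φ : ThreeCNF) : List Bool :=
  List.replicate φ.n true ++ [false] ++
    φ.clauses.flatMap fun c => (List.finRange 3).flatMap fun k => encodeLiteral (c k)

end ThreeCNF

/-- The Exponential Time Hypothesis: there is `δ > 0` such that 3-SAT with `n` variables cannot be
solved in time `O(2 ^ (δ n))`. -/
def ExponentialTimeHypothesis : Prop :=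
  ∃ δ : ℝ, 0 < δ ∧ ¬ ∃ (C : ℝ) (M : Turing.TM2ComputableAux Bool Bool),
    DecidesInTime ThreeCNF.encode ThreeCNF.Satisfiable
      (fun φ => C * (2 : ℝ) ^ (δ * (φ.n : ℝ))) M

/-! ### Monotone Narrow Grid Tiling -/

/-- An instance of (Monotone) Narrow Grid Tiling: a grid of `x ≥ 1` rows and `y ≥ 1` columns, an
integer `N`, and a non-empty set `S i j ⊆ {0, 1} × [N]` for each cell. -/
structure GridTilingInstance where
  x : ℕ
  y : ℕ
  N : ℕ
  x_pos : 0 < x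
  y_pos : 0 < y
  S : Fin x → Fin y → Finset (Bool × Fin N)
  S_nonempty : ∀ i j, (S i j).Nonempty

namespace GridTilingInstance

/-- The instance is a yes-instance of Monotone Narrow Grid Tiling: one can pick an element of each
cell's set so that the first components of vertically consecutive cells agree and the second
components do not decrease from a cell to the next one in its row. -/
def MonotoneSolvable (I : GridTilingInstance) : Prop :=
  ∃ s : Fin I.x → Fin I.y → Bool × Fin I.N,
    (∀ i j, s i j ∈ I.S i j) ∧
    (∀ (i i' : Fin I.x) (j : Fin I.y), (i' : ℕ) = (i : ℕ) + 1 → (s i j).1 = (s i' j).1) ∧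
    (∀ (i : Fin I.x) (j j' : Fin I.y), (j' : ℕ) = (j : ℕ) + 1 → (s i j).2 ≤ (s i j').2)

/-- `x`, `y` and `N` in unary, each followed by a delimiter, and then, cell by cell in row-major
order, the characteristic vector (of length `2 N`) of the set of the cell. -/
def encode (I : GridTilingInstance) : List Bool :=
  List.replicate I.x true ++ [false] ++
  List.replicate I.y true ++ [false] ++
  List.replicate I.N true ++ [false] ++
  (List.finRange I.x).flatMap fun i => (List.finRange I.y).flatMap fun j =>
    (List.finRange I.N).flatMap fun v =>
      [decide ((false, v) ∈ I.S i j), decide ((true, v) ∈ I.S i j)]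

end GridTilingInstance

/-!
A formula with `n` variables is encoded by a grid of width `2n + O(1)` whose number `R` of rows
does not depend on `n`. Distribute the variables among `g` groups. Each row sees three of the
groups, and its values are `2u + d`, where the binary digits of `u < 2 ^ (3 ⌈n / g⌉)` are the
truth values of the variables in these groups. The first components, shared by all rows, list an
assignment twice: in decreasing order of the variables on the left of a middle column, in
increasing order on the right. A cell on either side forces the first component to be the digit
that the value prescribes.

As the values increase along a row, reading the digits off a tiling from the most significant one
on shows that the value in the middle is at least the number of the left assignment and at most
that of the right one. A second row with the same groups and complemented digits gives the reverse
inequality, so the middle value is exactly the number of the left assignment, and there the row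
checks every clause within its three groups; every clause lies within the groups of some row.

The instance has area `x y ≈ 2 R n` and `N = 2 ^ O(n / g)`, and the latter is also, up to a
polynomial, the time to write it down. A large `g` makes `N ^ b` at most `O(2 ^ (δ n / 4))` and
the writing time at most `O(2 ^ (δ n))`, and `ε = δ / (4 R)` makes `2 ^ (ε x y)` at most
`O(2 ^ (δ n / 2))`.
-/

open Turing StateTransition

/-! ### Time-bounded runs -/

/-- The transition system `f` runs from `a` to `b` in at most `t` steps. -/
def RunsIn {α : Type*} (f : α → Option α) (a b : α) (t : ℕ) : Prop :=
  Nonempty (EvalsToInTime f a (some b) t)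

namespace RunsIn

variable {α β : Type*} {f : α → Option α} {a b c : α} {s t : ℕ}

theorem refl (f : α → Option α) (a : α) (t : ℕ) : RunsIn f a a t :=
  ⟨⟨EvalsTo.refl f a, Nat.zero_le t⟩⟩

theorem trans (hab : RunsIn f a b s) (hbc : RunsIn f b c t) : RunsIn f a c (s + t) := by
  obtain ⟨hab⟩ := hab
  obtain ⟨hbc⟩ := hbc
  rw [Nat.add_comm]
  exact ⟨EvalsToInTime.trans f s t a b _ hab hbc⟩

theorem mono (h : RunsIn f a b s) (hst : s ≤ t) : RunsIn f a b t := by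
  obtain ⟨h⟩ := h
  exact ⟨⟨h.toEvalsTo, h.steps_le_m.trans hst⟩⟩

theorem single (h : f a = some b) : RunsIn f a b 1 :=
  ⟨⟨⟨1, by simpa [flip] using h⟩, le_refl 1⟩⟩

theorem head (h : f a = some b) (hbc : RunsIn f b c t) : RunsIn f a c (t + 1) := by
  rw [Nat.add_comm]
  exact (single h).trans hbc

theorem map {f' : β → Option β} (φ : α → β)
    (hφ : ∀ a a', f a = some a' → f' (φ a) = some (φ a')) (h : RunsIn f a b t) :
    RunsIn f' (φ a) (φ b) t := by
  obtain ⟨⟨n, hn⟩, hnt⟩ := h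
  refine ⟨⟨⟨n, ?_⟩, hnt⟩⟩
  have iterate_none : ∀ n : ℕ, (flip bind f)^[n] (none : Option α) = none :=
    Function.iterate_fixed rfl
  clear hnt
  induction n generalizing a with
  | zero =>
    simp only [Function.iterate_zero, id] at hn ⊢
    rw [Option.some.inj hn]
  | succ n ih =>
    rw [Function.iterate_succ_apply] at hn ⊢
    change (flip bind f)^[n] (f a) = some b at hn
    change (flip bind f')^[n] (f' (φ a)) = some (φ b)
    cases hfa : f a with
    | none => rw [hfa, iterate_none] at hn; cases hn
    | some a' => rw [hfa] at hn; rw [hφ a a' hfa]; exact ih hn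

end RunsIn

/-! ### Sequential composition of stack machines -/

/-- The family of stack alphabets of two machines put side by side. -/
@[reducible] def sumAlphabet {K L : Type} (Γ : K → Type) (Δ : L → Type) : K ⊕ L → Type
  | .inl k => Γ k
  | .inr k => Δ k

/-- The stacks of two machines put side by side. -/
def joinStacks {K L : Type} {Γ : K → Type} {Δ : L → Type} (S : ∀ k, List (Γ k))
    (T : ∀ k, List (Δ k)) : ∀ k : K ⊕ L, List (sumAlphabet Γ Δ k)
  | .inl k => S k
  | .inr k => T k

section joinStacks

variable {K L : Type} {Γ : K → Type} {Δ : L → Type}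

theorem update_joinStacks_inl [DecidableEq K] [DecidableEq L] (S : ∀ k, List (Γ k))
    (T : ∀ k, List (Δ k)) (k : K) (l : List (Γ k)) :
    Function.update (joinStacks S T) (Sum.inl k) l = joinStacks (Function.update S k l) T := by
  refine Eq.symm (Function.eq_update_iff.2 ⟨?_, ?_⟩)
  · exact Function.update_self k l S
  rintro (k' | k') h
  · exact Function.update_of_ne (fun e => h (congrArg _ e)) l S
  · rfl

theorem update_joinStacks_inr [DecidableEq K] [DecidableEq L] (S : ∀ k, List (Γ k))
    (T : ∀ k, List (Δ k)) (k : L) (l : List (Δ k)) :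
    Function.update (joinStacks S T) (Sum.inr k) l = joinStacks S (Function.update T k l) := by
  refine Eq.symm (Function.eq_update_iff.2 ⟨?_, ?_⟩)
  · exact Function.update_self k l T
  rintro (k' | k') h
  · rfl
  · exact Function.update_of_ne (fun e => h (congrArg _ e)) l T

theorem joinStacks_nil :
    joinStacks (Γ := Γ) (Δ := Δ) (fun _ => []) (fun _ => []) = fun _ => [] := by
  funext k
  cases k <;> rfl

end joinStacks

theorem initList_stk (tm : FinTM2) (s : List (tm.Γ tm.k₀)) :
    (initList tm s).stk = Function.update (fun _ => []) tm.k₀ s := by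
  funext k
  by_cases h : k = tm.k₀
  · subst h; simp [initList]
  · simp [initList, h]

theorem haltList_stk (tm : FinTM2) (s : List (tm.Γ tm.k₁)) :
    (haltList tm s).stk = Function.update (fun _ => []) tm.k₁ s := by
  funext k
  by_cases h : k = tm.k₁
  · subst h; simp [haltList]
  · simp [haltList, h]

namespace reverseComp

variable (A B : FinTM2)

/-- Internal states of the composite machine: those of both machines and the symbol being
moved from the output stack of the first to the input stack of the second. -/
abbrev State : Type := A.σ × B.σ × Option (B.Γ B.k₀)

/-- Labels of the composite machine; `Sum.inr none` is the loop that moves the output of the first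
machine to the input stack of the second. -/
abbrev Label : Type := A.Λ ⊕ Option B.Λ

/-- Statements of the composite machine. -/
abbrev Stmt : Type := TM2.Stmt (sumAlphabet A.Γ B.Γ) (Label A B) (State A B)

/-- Configurations of the composite machine. -/
abbrev Cfg : Type := TM2.Cfg (sumAlphabet A.Γ B.Γ) (Label A B) (State A B)

/-- The statements of the first machine inside the composite machine, where `halt` passes control
to the moving loop. -/
def leftStmt : TM2.Stmt A.Γ A.Λ A.σ → Stmt A B
  | .push k f q => .push (Sum.inl k) (fun s => f s.1) (leftStmt q)
  | .peek k f q => .peek (Sum.inl k) (fun s o => (f s.1 o, s.2)) (leftStmt q)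
  | .pop k f q => .pop (Sum.inl k) (fun s o => (f s.1 o, s.2)) (leftStmt q)
  | .load f q => .load (fun s => (f s.1, s.2)) (leftStmt q)
  | .branch f q₁ q₂ => .branch (fun s => f s.1) (leftStmt q₁) (leftStmt q₂)
  | .goto f => .goto fun s => Sum.inl (f s.1)
  | .halt => .goto fun _ => Sum.inr none

/-- The statements of the second machine inside the composite machine. -/
def rightStmt : TM2.Stmt B.Γ B.Λ B.σ → Stmt A B
  | .push k f q => .push (Sum.inr k) (fun s => f s.2.1) (rightStmt q)
  | .peek k f q => .peek (Sum.inr k) (fun s o => (s.1, f s.2.1 o, s.2.2)) (rightStmt q)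
  | .pop k f q => .pop (Sum.inr k) (fun s o => (s.1, f s.2.1 o, s.2.2)) (rightStmt q)
  | .load f q => .load (fun s => (s.1, f s.2.1, s.2.2)) (rightStmt q)
  | .branch f q₁ q₂ => .branch (fun s => f s.2.1) (rightStmt q₁) (rightStmt q₂)
  | .goto f => .goto fun s => Sum.inr (some (f s.2.1))
  | .halt => .halt

variable {A B}

/-- A configuration of the first machine inside the composite machine. -/
def leftCfg (T : ∀ k, List (B.Γ k)) (b : B.σ × Option (B.Γ B.k₀))
    (c : TM2.Cfg A.Γ A.Λ A.σ) : Cfg A B where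
  l := some (c.l.elim (Sum.inr none) Sum.inl)
  var := (c.var, b)
  stk := joinStacks c.stk T

/-- A configuration of the second machine inside the composite machine. -/
def rightCfg (S : ∀ k, List (A.Γ k)) (a : A.σ) (o : Option (B.Γ B.k₀))
    (c : TM2.Cfg B.Γ B.Λ B.σ) : Cfg A B where
  l := c.l.map fun l => Sum.inr (some l)
  var := (a, c.var, o)
  stk := joinStacks S c.stk

theorem stepAux_leftStmt (q : TM2.Stmt A.Γ A.Λ A.σ) (v : A.σ) (b : B.σ × Option (B.Γ B.k₀))
    (S : ∀ k, List (A.Γ k)) (T : ∀ k, List (B.Γ k)) :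
    TM2.stepAux (leftStmt A B q) (v, b) (joinStacks S T) = leftCfg T b (TM2.stepAux q v S) := by
  induction q generalizing v S with
  | push k f q ih => exact (congrArg _ (update_joinStacks_inl S T k _)).trans (ih _ _)
  | peek k f _ ih => exact ih _ _
  | pop k f q ih => exact (congrArg _ (update_joinStacks_inl S T k _)).trans (ih _ _)
  | load f _ ih => exact ih _ _
  | branch f q₁ q₂ ih₁ ih₂ =>
    simp only [leftStmt, TM2.stepAux]
    cases f v
    · exact ih₂ _ _
    · exact ih₁ _ _
  | goto f => rfl
  | halt => rfl

theorem stepAux_rightStmt (q : TM2.Stmt B.Γ B.Λ B.σ) (a : A.σ) (v : B.σ)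
    (o : Option (B.Γ B.k₀)) (S : ∀ k, List (A.Γ k)) (T : ∀ k, List (B.Γ k)) :
    TM2.stepAux (rightStmt A B q) (a, v, o) (joinStacks S T) =
      rightCfg S a o (TM2.stepAux q v T) := by
  induction q generalizing v T with
  | push k f q ih => exact (congrArg _ (update_joinStacks_inr S T k _)).trans (ih _ _)
  | peek k f _ ih => exact ih _ _
  | pop k f q ih => exact (congrArg _ (update_joinStacks_inr S T k _)).trans (ih _ _)
  | load f _ ih => exact ih _ _
  | branch f q₁ q₂ ih₁ ih₂ =>
    simp only [rightStmt, TM2.stepAux]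
    cases f v
    · exact ih₂ _ _
    · exact ih₁ _ _
  | goto f => rfl
  | halt => rfl

end reverseComp

open reverseComp in
/-- The machine that runs `A`, moves its output symbol by symbol, translated by `conv` and thereby
reversed, to the input stack of `B`, and runs `B`. -/
def reverseComp (A B : FinTM2) [Inhabited (B.Γ B.k₀)] (conv : A.Γ A.k₁ → B.Γ B.k₀) : FinTM2 where
  K := A.K ⊕ B.K
  kDecidableEq := inferInstance
  kFin := @instFintypeSum _ _ A.kFin B.kFin
  k₀ := Sum.inl A.k₀
  k₁ := Sum.inr B.k₁
  Γ := sumAlphabet A.Γ B.Γ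
  Λ := Label A B
  main := Sum.inl A.main
  ΛFin := @instFintypeSum _ _ A.ΛFin (@instFintypeOption _ B.ΛFin)
  σ := State A B
  initialState := (A.initialState, B.initialState, none)
  σFin := @instFintypeProd _ _ A.σFin (@instFintypeProd _ _ B.σFin
    (@instFintypeOption _ B.Γk₀Fin))
  Γk₀Fin := A.Γk₀Fin
  m
    | Sum.inl l => leftStmt A B (A.m l)
    | Sum.inr (some l) => rightStmt A B (B.m l)
    | Sum.inr none =>
      .pop (Sum.inl A.k₁) (fun s o => (s.1, s.2.1, o.map conv)) <|
        .branch (fun s => s.2.2.isSome)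
          (.push (Sum.inr B.k₀) (fun s => s.2.2.getD default) <|
            .goto fun _ => Sum.inr none)
          (.goto fun _ => Sum.inr (some B.main))

namespace reverseComp

variable {A B : FinTM2} [Inhabited (B.Γ B.k₀)] (conv : A.Γ A.k₁ → B.Γ B.k₀)

theorem initList_eq (s : List (A.Γ A.k₀)) :
    initList (reverseComp A B conv) s =
      leftCfg (fun _ => []) (B.initialState, none) (initList A s) := by
  have stk_eq : (initList (reverseComp A B conv) s).stk =
      joinStacks (initList A s).stk (fun _ => []) := by
    rw [initList_stk A, ← update_joinStacks_inl, joinStacks_nil]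
    exact initList_stk (reverseComp A B conv) s
  exact congrArg (TM2.Cfg.mk _ _) stk_eq

theorem haltList_eq (s : List (B.Γ B.k₁)) :
    haltList (reverseComp A B conv) s =
      rightCfg (fun _ => []) A.initialState none (haltList B s) := by
  have stk_eq : (haltList (reverseComp A B conv) s).stk =
      joinStacks (fun _ => []) (haltList B s).stk := by
    rw [haltList_stk B, ← update_joinStacks_inr, joinStacks_nil]
    exact haltList_stk (reverseComp A B conv) s
  exact congrArg (TM2.Cfg.mk _ _) stk_eq

/-- The configuration of the composite machine in the moving loop, with the output `w` of the first
machine and the input `u` of the second one. -/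
def transferCfg (w : List (A.Γ A.k₁)) (u : List (B.Γ B.k₀)) (o : Option (B.Γ B.k₀)) :
    Cfg A B where
  l := some (Sum.inr none)
  var := (A.initialState, B.initialState, o)
  stk := joinStacks (Function.update (fun _ => []) A.k₁ w) (Function.update (fun _ => []) B.k₀ u)

theorem step_transferCfg_nil (u : List (B.Γ B.k₀)) (o : Option (B.Γ B.k₀)) :
    (reverseComp A B conv).step (transferCfg [] u o) =
      some (rightCfg (fun _ => []) A.initialState none (initList B u)) := by
  refine congrArg some ?_
  have step_eq : ∀ (S : ∀ k, List (A.Γ k)) (T : ∀ k, List (B.Γ k)), S A.k₁ = [] →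
      TM2.stepAux ((reverseComp A B conv).m (Sum.inr none))
        (A.initialState, B.initialState, o) (joinStacks S T) =
      ⟨some (Sum.inr (some B.main)), (A.initialState, B.initialState, none),
        joinStacks (Function.update S A.k₁ []) T⟩ := by
    intro S T hS
    have hS' : joinStacks S T (Sum.inl A.k₁) = [] := hS
    simp only [reverseComp, TM2.stepAux]
    rw [hS']
    exact congrArg (TM2.Cfg.mk _ _) (update_joinStacks_inl S T A.k₁ [])
  refine (step_eq _ _ (Function.update_self _ _ _)).trans ?_
  exact congrArg (TM2.Cfg.mk _ _) (congrArg₂ joinStacks (by simp) (initList_stk B u).symm)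

theorem step_transferCfg_cons (x : A.Γ A.k₁) (w : List (A.Γ A.k₁)) (u : List (B.Γ B.k₀))
    (o : Option (B.Γ B.k₀)) :
    (reverseComp A B conv).step (transferCfg (x :: w) u o) =
      some (transferCfg w (conv x :: u) (some (conv x))) := by
  refine congrArg some ?_
  have step_eq : ∀ (S : ∀ k, List (A.Γ k)) (T : ∀ k, List (B.Γ k)), S A.k₁ = x :: w →
      TM2.stepAux ((reverseComp A B conv).m (Sum.inr none))
        (A.initialState, B.initialState, o) (joinStacks S T) =
      ⟨some (Sum.inr none), (A.initialState, B.initialState, some (conv x)),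
        joinStacks (Function.update S A.k₁ w)
          (Function.update T B.k₀ (conv x :: T B.k₀))⟩ := by
    intro S T hS
    have hS' : joinStacks S T (Sum.inl A.k₁) = x :: w := hS
    simp only [reverseComp, TM2.stepAux]
    rw [hS']
    refine congrArg (TM2.Cfg.mk _ _) ?_
    refine (congrArg (fun R : ∀ k, List (sumAlphabet A.Γ B.Γ k) => Function.update R
      (Sum.inr B.k₀) (conv x :: R (Sum.inr B.k₀))) (update_joinStacks_inl S T A.k₁ w)).trans ?_
    exact update_joinStacks_inr _ _ _ _
  refine (step_eq _ _ (Function.update_self _ _ _)).trans ?_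
  exact congrArg (TM2.Cfg.mk _ _) (congrArg₂ joinStacks (by simp) (by simp))

theorem runsIn_transfer (w : List (A.Γ A.k₁)) (u : List (B.Γ B.k₀)) (o : Option (B.Γ B.k₀)) :
    RunsIn (reverseComp A B conv).step (transferCfg w u o)
      (rightCfg (fun _ => []) A.initialState none
        (initList B ((w.map conv).reverse ++ u))) (w.length + 1) := by
  induction w generalizing u o with
  | nil => exact RunsIn.single (step_transferCfg_nil conv u o)
  | cons x w ih =>
    rw [List.map_cons, List.reverse_cons, List.append_assoc]
    exact RunsIn.head (step_transferCfg_cons conv x w u o) (ih _ _)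

protected theorem runsIn {u : List (A.Γ A.k₀)} {w : List (A.Γ A.k₁)} {r : List (B.Γ B.k₁)}
    {s t : ℕ} (hA : RunsIn A.step (initList A u) (haltList A w) s)
    (hB : RunsIn B.step (initList B (w.map conv).reverse) (haltList B r) t) :
    RunsIn (reverseComp A B conv).step (initList (reverseComp A B conv) u)
      (haltList (reverseComp A B conv) r) (s + (w.length + 1) + t) := by
  rw [initList_eq, haltList_eq]
  have run_left := hA.map (f' := (reverseComp A B conv).step)
    (leftCfg (fun _ => []) (B.initialState, none)) (by
      rintro ⟨_ | l, v, S⟩ c' h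
      · cases h
      · obtain rfl := Option.some.inj h
        exact congrArg some (stepAux_leftStmt _ _ _ _ _))
  have run_right := hB.map (f' := (reverseComp A B conv).step)
    (rightCfg (fun _ => []) A.initialState none) (by
      rintro ⟨_ | l, v, S⟩ c' h
      · cases h
      · obtain rfl := Option.some.inj h
        exact congrArg some (stepAux_rightStmt _ _ _ _ _ _))
  have transfer := runsIn_transfer conv w [] none
  rw [List.append_nil, transferCfg, Function.update_eq_self, ← haltList_stk A w] at transfer
  exact (run_left.trans transfer).trans run_right

end reverseComp

/-! ### Deciding problems by reduction -/

/-- The machine `A`, given as input the word `u`, halts after at most `t` steps with output `w`. -/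
def OutputsWithin {α β : Type} (A : TM2ComputableAux α β) (u : List α) (w : List β) (t : ℕ) :
    Prop :=
  RunsIn A.tm.step (initList A.tm (u.map A.inputAlphabet.symm))
    (haltList A.tm (w.map A.outputAlphabet.symm)) t

/-- `reverseComp` for machines with prescribed input and output alphabets. -/
def composeReversed {α β γ : Type} [Inhabited β] (A : TM2ComputableAux α β)
    (B : TM2ComputableAux β γ) : TM2ComputableAux α γ where
  tm := @reverseComp A.tm B.tm ⟨B.inputAlphabet.symm default⟩
    (fun x => B.inputAlphabet.symm (A.outputAlphabet x))
  inputAlphabet := A.inputAlphabet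
  outputAlphabet := B.outputAlphabet

theorem OutputsWithin.composeReversed {α β γ : Type} [Inhabited β] {A : TM2ComputableAux α β}
    {B : TM2ComputableAux β γ} {u : List α} {w : List β} {r : List γ} {s t : ℕ}
    (hA : OutputsWithin A u w s) (hB : OutputsWithin B w.reverse r t) :
    OutputsWithin (composeReversed A B) u r (s + (w.length + 1) + t) := by
  let _ : Inhabited (B.tm.Γ B.tm.k₀) := ⟨B.inputAlphabet.symm default⟩
  have run := reverseComp.runsIn (fun x => B.inputAlphabet.symm (A.outputAlphabet x))
    (w := w.map A.outputAlphabet.symm) (r := r.map B.outputAlphabet.symm) hA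
    (by simpa [OutputsWithin, Function.comp_def] using hB)
  rwa [List.length_map] at run

theorem DecidesInTime.mono {α : Type} {enc : α → List Bool} {P : α → Prop} {t t' : α → ℝ}
    {M : TM2ComputableAux Bool Bool} (h : DecidesInTime enc P t M) (ht : ∀ a, t a ≤ t' a) :
    DecidesInTime enc P t' M := fun a =>
  let ⟨answer, m, hanswer, hm, hrun⟩ := h a
  ⟨answer, m, hanswer, hm.trans (ht a), hrun⟩

theorem DecidesInTime.of_reduction {α β : Type} {enc : α → List Bool} {enc' : β → List Bool}
    {P : α → Prop} {P' : β → Prop} {f : α → β} {A M : TM2ComputableAux Bool Bool} {s : α → ℕ}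
    {t : β → ℝ} (hP : ∀ a, P' (f a) ↔ P a)
    (hA : ∀ a, OutputsWithin A (enc a) (enc' (f a)).reverse (s a))
    (hM : DecidesInTime enc' P' t M) :
    DecidesInTime enc P (fun a => s a + ((enc' (f a)).length + 1) + t (f a))
      (composeReversed A M) := by
  intro a
  obtain ⟨answer, m, hanswer, hm, hrun⟩ := hM (f a)
  have run := (hA a).composeReversed (r := [answer]) (t := m) (by rwa [List.reverse_reverse])
  rw [List.length_reverse] at run
  refine ⟨answer, _, hanswer.trans (hP a), ?_, run⟩
  push_cast
  linarith

/-! ### Numbers whose digits are spread over a word -/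

section spread

variable {γ : Type} (active : γ → Bool)

/-- The binary digits of `v`, least significant first, spread over the active letters of a word; the
digit at an inactive letter is `false`. -/
def spreadDigits : List γ → ℕ → List (γ × Bool)
  | [], _ => []
  | x :: G, v =>
    if active x then (x, decide (v % 2 = 1)) :: spreadDigits G (v / 2)
    else (x, false) :: spreadDigits G v

/-- The number whose digit at every active position `t` of a word is `A t`. -/
def spreadValue : List γ → (ℕ → Bool) → ℕ
  | [], _ => 0
  | x :: G, A =>
    if active x then (A 0).toNat + 2 * spreadValue G (fun t => A (t + 1))
    else spreadValue G fun t => A (t + 1)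

variable {active}

theorem length_spreadDigits (G : List γ) (v : ℕ) :
    (spreadDigits active G v).length = G.length := by
  induction G generalizing v with
  | nil => rfl
  | cons x G ih => rw [spreadDigits]; split <;> simp [ih]

theorem spreadDigits_zero (G : List γ) :
    spreadDigits active G 0 = G.map fun x => (x, false) := by
  induction G with
  | nil => rfl
  | cons x G ih => rw [spreadDigits]; split <;> simp [ih]

theorem spreadDigits_two_pow (G : List γ) :
    spreadDigits active G (2 ^ G.countP active) = spreadDigits active G 0 := by
  induction G with
  | nil => rfl
  | cons x G ih =>
    by_cases hx : active x
    · simp [spreadDigits, hx, pow_succ, ih]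
    · simp [spreadDigits, hx, ih]

theorem map_fst_getElem?_spreadDigits (G : List γ) (v t : ℕ) :
    (spreadDigits active G v)[t]?.map Prod.fst = G[t]? := by
  induction G generalizing v t with
  | nil => simp [spreadDigits]
  | cons x G ih =>
    rw [spreadDigits]
    split <;> cases t <;> simp [ih]

theorem spreadValue_lt (G : List γ) (A : ℕ → Bool) :
    spreadValue active G A < 2 ^ G.countP active := by
  induction G generalizing A with
  | nil => simp [spreadValue]
  | cons x G ih =>
    have tail_lt := ih fun t => A (t + 1)
    by_cases hx : active x = true
    · have head_le := Bool.toNat_le (A 0)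
      rw [List.countP_cons_of_pos hx, pow_succ, spreadValue, if_pos hx]
      omega
    · rwa [List.countP_cons_of_neg hx, spreadValue, if_neg hx]

theorem spreadValue_add_spreadValue_not (G : List γ) (A : ℕ → Bool) :
    spreadValue active G A + spreadValue active G (fun t => !A t) + 1 = 2 ^ G.countP active := by
  induction G generalizing A with
  | nil => simp [spreadValue]
  | cons x G ih =>
    have tail_eq := ih fun t => A (t + 1)
    by_cases hx : active x = true
    · have head_eq : (A 0).toNat + (!A 0).toNat = 1 := by cases A 0 <;> rfl
      rw [List.countP_cons_of_pos hx, pow_succ, spreadValue, if_pos hx, spreadValue, if_pos hx]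
      omega
    · rwa [List.countP_cons_of_neg hx, spreadValue, if_neg hx, spreadValue, if_neg hx]

theorem getElem?_spreadDigits_spreadValue (G : List γ) (A : ℕ → Bool) (t : ℕ) :
    (spreadDigits active G (spreadValue active G A))[t]? =
      G[t]?.map fun x => (x, active x && A t) := by
  induction G generalizing A t with
  | nil => simp [spreadDigits]
  | cons x G ih =>
    by_cases hx : active x = true
    · have head_lt := Bool.toNat_lt (A 0)
      rw [spreadValue, if_pos hx, spreadDigits, if_pos hx, Nat.add_mul_mod_self_left,
        Nat.add_mul_div_left _ _ two_pos, Nat.div_eq_of_lt head_lt, zero_add,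
        Nat.mod_eq_of_lt head_lt]
      cases t with
      | zero => simp [hx]
      | succ t => simpa using ih _ t
    · rw [spreadValue, if_neg hx, spreadDigits, if_neg hx]
      cases t with
      | zero => simp [hx]
      | succ t => simpa using ih _ t

/-- The digit at every active position `t` of the number `u t` is `A t`. -/
def HasDigits (active : γ → Bool) (G : List γ) (u : ℕ → ℕ) (A : ℕ → Bool) : Prop :=
  ∀ t x, G[t]? = some x → active x = true →
    (spreadDigits active G (u t))[t]? = some (x, A t)

namespace HasDigits

variable {x : γ} {G : List γ} {u : ℕ → ℕ} {A : ℕ → Bool}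

theorem toNat_head (h : HasDigits active (x :: G) u A) (hx : active x = true) :
    (A 0).toNat = u 0 % 2 := by
  have digit_eq : decide (u 0 % 2 = 1) = A 0 := by
    simpa [spreadDigits, hx] using h 0 x (by simp) hx
  rw [← digit_eq]
  rcases Nat.mod_two_eq_zero_or_one (u 0) with hu | hu <;> simp [hu]

theorem tail_of_active (h : HasDigits active (x :: G) u A) (hx : active x = true) :
    HasDigits active G (fun t => u (t + 1) / 2) (fun t => A (t + 1)) := fun t y hy hy' => by
  simpa [spreadDigits, hx] using h (t + 1) y (by simpa using hy) hy'

theorem tail_of_not_active (h : HasDigits active (x :: G) u A) (hx : ¬active x = true) :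
    HasDigits active G (fun t => u (t + 1)) (fun t => A (t + 1)) := fun t y hy hy' => by
  simpa [spreadDigits, hx] using h (t + 1) y (by simpa using hy) hy'

theorem spreadValue_le (h : HasDigits active G u A) (hu : Antitone u) :
    spreadValue active G A ≤ u 0 := by
  induction G generalizing A u with
  | nil => simp [spreadValue]
  | cons x G ih =>
    have head_le : u 1 ≤ u 0 := hu zero_le_one
    by_cases hx : active x = true
    · have tail_le := ih (h.tail_of_active hx)
        fun s t hst => Nat.div_le_div_right (hu (Nat.succ_le_succ hst))
      have head_eq := h.toNat_head hx
      simp only [zero_add] at tail_le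
      rw [spreadValue, if_pos hx]
      omega
    · rw [spreadValue, if_neg hx]
      exact (ih (h.tail_of_not_active hx) fun s t hst => hu (Nat.succ_le_succ hst)).trans head_le

theorem le_spreadValue (h : HasDigits active G u A) (hu : Monotone u)
    (hlt : ∀ t, u t < 2 ^ G.countP active) : u 0 ≤ spreadValue active G A := by
  induction G generalizing A u with
  | nil => exact (Nat.lt_one_iff.1 (by simpa using hlt 0)).le
  | cons x G ih =>
    have head_le : u 0 ≤ u 1 := hu zero_le_one
    by_cases hx : active x = true
    · rw [List.countP_cons_of_pos hx, pow_succ] at hlt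
      have le_tail := ih (h.tail_of_active hx)
        (fun s t hst => Nat.div_le_div_right (hu (Nat.succ_le_succ hst)))
        fun t => Nat.div_lt_of_lt_mul (by simpa only [mul_comm] using hlt (t + 1))
      have head_eq := h.toNat_head hx
      simp only [zero_add] at le_tail
      rw [spreadValue, if_pos hx]
      omega
    · rw [List.countP_cons_of_neg hx] at hlt
      rw [spreadValue, if_neg hx]
      exact head_le.trans (ih (h.tail_of_not_active hx)
        (fun s t hst => hu (Nat.succ_le_succ hst)) fun t => hlt (t + 1))

end HasDigits

end spread

/-! ### Residue classes of positions -/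

/-- The residue classes modulo `g` of `m - 1, …, 0`. -/
def residues (g : ℕ) : ℕ → List (ZMod g)
  | 0 => []
  | m + 1 => (m : ZMod g) :: residues g m

theorem length_residues (g m : ℕ) : (residues g m).length = m := by
  induction m with
  | zero => rfl
  | succ m ih => simp [residues, ih]

theorem countP_residues {g : ℕ} (p : ZMod g → Bool) (m : ℕ) :
    (residues g m).countP p = Nat.count (fun t : ℕ => p t = true) m := by
  induction m with
  | zero => rfl
  | succ m ih => rw [residues, List.countP_cons, ih, Nat.count_succ]

theorem count_natCast_mem {g : ℕ} [NeZero g] (T : Finset (ZMod g)) :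
    Nat.count (fun t : ℕ => (t : ZMod g) ∈ T) g = T.card := by
  rw [Nat.count_eq_card_filter_range]
  refine Finset.card_nbij' (fun t : ℕ => (t : ZMod g)) ZMod.val ?_ ?_ ?_ ?_
  · intro t ht
    exact (Finset.mem_filter.1 ht).2
  · intro x hx
    simpa [ZMod.val_lt] using hx
  · intro t ht
    exact ZMod.val_cast_of_lt (by simpa using (Finset.mem_filter.1 ht).1)
  · intro x _
    exact ZMod.natCast_rightInverse x

theorem countP_mem_residues_mul {g : ℕ} [NeZero g] (T : Finset (ZMod g)) (h : ℕ) :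
    (residues g (g * h)).countP (fun x => decide (x ∈ T)) = T.card * h := by
  simp only [countP_residues, decide_eq_true_eq]
  induction h with
  | zero => simp
  | succ h ih =>
    rw [Nat.mul_succ, Nat.count_add, ih, Nat.mul_succ]
    simp only [Nat.cast_add, Nat.cast_mul, CharP.cast_eq_zero, zero_mul, zero_add,
      count_natCast_mem]

/-- The least multiple of `g` that is at least `n`. -/
def width (g n : ℕ) : ℕ := g * (n ⌈/⌉ g)

theorem le_width {g : ℕ} [NeZero g] (n : ℕ) : n ≤ width g n := by
  simpa [width] using le_smul_ceilDiv (b := n) (NeZero.pos g)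

theorem width_lt {g : ℕ} [NeZero g] (n : ℕ) : width g n < n + g := by
  have hg := NeZero.pos g
  have := Nat.mul_div_le (n + g - 1) g
  rw [width, Nat.ceilDiv_eq_add_pred_div]
  omega

/-! ### The rows of the grid -/

/-- The rows of the grid for `g` groups of variables: row `i` sees the variables of the three groups
`groups i`, and lists their digits complemented if `negated i`. -/
structure RowScheme (g : ℕ) where
  rows : ℕ
  groups : Fin rows → Finset (ZMod g)
  negated : Fin rows → Bool
  card_groups : ∀ i, (groups i).card = 3
  exists_covering : ∀ f : Fin 3 → ZMod g, ∃ i i', groups i' = groups i ∧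
    negated i = false ∧ negated i' = true ∧ ∀ k, f k ∈ groups i

namespace RowScheme

theorem nonempty {g : ℕ} (hg : 3 ≤ g) : Nonempty (RowScheme g) := by
  classical
  have : NeZero g := ⟨by omega⟩
  let Row : Type := {T : Finset (ZMod g) // T.card = 3} × Bool
  let e : Fin (Fintype.card Row) ≃ Row := (Fintype.equivFin Row).symm
  refine ⟨Fintype.card Row, fun i => (e i).1.1, fun i => (e i).2, fun i => (e i).1.2,
    fun f => ?_⟩
  obtain ⟨T, hfT, hT⟩ : ∃ T : Finset (ZMod g), Finset.univ.image f ⊆ T ∧ T.card = 3 :=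
    Finset.exists_superset_card_eq (Finset.card_image_le.trans (by simp)) (by rwa [ZMod.card])
  refine ⟨e.symm (⟨T, hT⟩, false), e.symm (⟨T, hT⟩, true), by simp, by simp, by simp, fun k => ?_⟩
  simpa using hfT (Finset.mem_image_of_mem f (Finset.mem_univ k))

variable {g : ℕ} (S : RowScheme g)

instance neZero_rows : NeZero S.rows :=
  ⟨fun h => (S.exists_covering 0).elim fun i _ => (Fin.cast h i).elim0⟩

/-- Whether row `i` sees the variables of the group `x`. -/
def active (i : Fin S.rows) (x : ZMod g) : Bool := decide (x ∈ S.groups i)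

/-- Whether row `i` lets a position `x.1` with digit `x.2` have the value `a`. -/
def fits (i : Fin S.rows) (x : ZMod g × Bool) (a : Bool) : Bool :=
  !S.active i x.1 || a == xor x.2 (S.negated i)

/-- The number of binary digits of the values in the grid for `n` variables. -/
def numDigits (g n : ℕ) : ℕ := 3 * (n ⌈/⌉ g)

theorem countP_active [NeZero g] (i : Fin S.rows) (n : ℕ) :
    (residues g (width g n)).countP (S.active i) = numDigits g n := by
  rw [numDigits, ← S.card_groups i]
  exact countP_mem_residues_mul _ _

end RowScheme

/-! ### The machine that writes down the grid -/

theorem replicate_append_cons_self {α : Type*} (n : ℕ) (x : α) (l : List α) :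
    List.replicate n x ++ x :: l = List.replicate (n + 1) x ++ l := by
  rw [List.append_cons, ← List.replicate_succ']

theorem flatMap_range_two_mul {α : Type*} (m : ℕ) (f : ℕ → List α) :
    (List.range (2 * m)).flatMap f =
      (List.range m).flatMap fun u => f (2 * u) ++ f (2 * u + 1) := by
  induction m with
  | zero => rfl
  | succ m ih =>
    rw [show 2 * (m + 1) = 2 * m + 1 + 1 by ring]
    simp [List.range_succ, ih]

theorem flatMap_finRange {α : Type*} (m : ℕ) (f : ℕ → List α) :
    ((List.finRange m).flatMap fun j => f j.1) = (List.range m).flatMap f := by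
  rw [← List.map_coe_finRange_eq_range, List.flatMap_map]

namespace GridWriter

/-- The stacks: the formula and the part of it that has been read, the word of digits and the part
of it that has been read, the number of the current column and the number of the columns before it
in unary, the output. -/
inductive Stack
  | formula | formulaRead | word | wordRead | column | columnsDone | out
deriving DecidableEq

instance : Fintype Stack where
  elems := {.formula, .formulaRead, .word, .wordRead, .column, .columnsDone, .out}
  complete k := by cases k <;> simp

/-- The stack alphabets. -/
@[reducible] def alphabet (γ : Type) : Stack → Type
  | .formula | .formulaRead | .column | .columnsDone | .out => Bool
  | .word | .wordRead => γ × Bool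

/-- The contents of all stacks. -/
structure Mem (γ : Type) where
  formula : List Bool
  formulaRead : List Bool
  word : List (γ × Bool)
  wordRead : List (γ × Bool)
  column : List Bool
  columnsDone : List Bool
  out : List Bool

/-- The contents between two passes over the word and the formula, when nothing is read. -/
def Mem.ready {γ : Type} (formula : List Bool) (word : List (γ × Bool))
    (column columnsDone : ℕ) (out : List Bool) : Mem γ where
  formula := formula
  formulaRead := []
  word := word
  wordRead := []
  column := List.replicate column true
  columnsDone := List.replicate columnsDone true
  out := out

/-- The contents as a family of stacks. -/
@[simp] def Mem.stk {γ : Type} (m : Mem γ) : ∀ k, List (alphabet γ k)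
  | .formula => m.formula
  | .formulaRead => m.formulaRead
  | .word => m.word
  | .wordRead => m.wordRead
  | .column => m.column
  | .columnsDone => m.columnsDone
  | .out => m.out

namespace Mem

variable {γ : Type} (m : Mem γ)

@[simp] theorem update_formula (l : List Bool) :
    Function.update m.stk .formula l = {m with formula := l}.stk := by
  funext k; cases k <;> rfl

@[simp] theorem update_formulaRead (l : List Bool) :
    Function.update m.stk .formulaRead l = {m with formulaRead := l}.stk := by
  funext k; cases k <;> rfl

@[simp] theorem update_word (l : List (γ × Bool)) :
    Function.update m.stk .word l = {m with word := l}.stk := by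
  funext k; cases k <;> rfl

@[simp] theorem update_wordRead (l : List (γ × Bool)) :
    Function.update m.stk .wordRead l = {m with wordRead := l}.stk := by
  funext k; cases k <;> rfl

@[simp] theorem update_column (l : List Bool) :
    Function.update m.stk .column l = {m with column := l}.stk := by
  funext k; cases k <;> rfl

@[simp] theorem update_columnsDone (l : List Bool) :
    Function.update m.stk .columnsDone l = {m with columnsDone := l}.stk := by
  funext k; cases k <;> rfl

@[simp] theorem update_out (l : List Bool) :
    Function.update m.stk .out l = {m with out := l}.stk := by
  funext k; cases k <;> rfl

end Mem

/-- What is written for each value of the digits: a unary `2`, or four bits of a cell in a column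
left of the check column, in the check column, or right of it. -/
inductive Kind
  | header | first | check | second
deriving DecidableEq

instance : Fintype Kind where
  elems := {.header, .first, .check, .second}
  complete κ := by cases κ <;> simp

/-- The labels; `i` is the current row, `k` the current literal of a clause, `sat` tells whether the
current clause already has a true literal and `ok` whether the previous clauses are satisfied. -/
inductive Label (γ ρ : Type)
  | start
  | read (x : γ)
  | pad (x : γ)
  | emit (i : ρ) (κ : Kind)
  | walk (i : ρ) (κ : Kind)
  | back (i : ρ) (κ : Kind)
  | literal (i : ρ) (k : Fin 3) (sat ok : Bool)
  | sign (i : ρ) (k : Fin 3) (sat ok : Bool)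
  | unread (i : ρ) (k : Fin 3) (sat ok : Bool)
  | rewind (i : ρ) (ok : Bool)
  | increment (i : ρ) (κ : Kind)
  | carry (i : ρ) (κ : Kind) (overflow : Bool)
  | next (i : ρ) (κ : Kind)
  | firstColumns (i : ρ)
  | secondColumns (i : ρ)
  | clean
deriving Fintype

/-- The register: the bit and the digit that have been read last. -/
abbrev Register (γ : Type) : Type := Option Bool × Option (γ × Bool)

/-- The bit in the register. -/
def Register.bit {γ : Type} (v : Register γ) : Bool := v.1.getD false

/-- The digit in the register. -/
def Register.digit {γ : Type} [Zero γ] (v : Register γ) : γ × Bool := v.2.getD (0, false)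

/-- Statements of the machine. -/
abbrev Code (γ ρ : Type) : Type := TM2.Stmt (alphabet γ) (Label γ ρ) (Register γ)

variable {γ ρ : Type}

/-- Write a list of bits. -/
def write (l : List Bool) (q : Code γ ρ) : Code γ ρ :=
  l.foldr (fun b q => .push .out (fun _ => b) q) q

theorem stepAux_write (l : List Bool) (q : Code γ ρ) (v : Register γ) (m : Mem γ) :
    TM2.stepAux (write l q) v m.stk =
      TM2.stepAux q v {m with out := l.reverse ++ m.out}.stk := by
  induction l generalizing m with
  | nil => rfl
  | cons b l ih =>
    change TM2.stepAux (write l q) v (Function.update m.stk .out (b :: m.out)) = _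
    rw [Mem.update_out, ih]
    simp

end GridWriter

open GridWriter

namespace RowScheme

variable {g : ℕ} (S : RowScheme g)

/-- The program. -/
def code : Label (ZMod g) (Fin S.rows) → Code (ZMod g) (Fin S.rows)
  | .start => write (List.replicate S.rows true ++ [false]) <| .goto fun _ => .read 0
  | .read x =>
    .pop .formula (fun v o => (o, v.2)) <|
    .branch (fun v => v.bit)
      (.push .word (fun _ => (x, false)) <| .push .column (fun _ => true) <|
        write [true, true] <| .goto fun _ => .read (x + 1))
      (.goto fun _ => .pad x)
  | .pad x =>
    if x = 0 then write [true, false] <| .goto fun _ => .emit 0 .header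
    else .push .word (fun _ => (x, false)) <| .push .column (fun _ => true) <|
      write [true, true] <| .goto fun _ => .pad (x + 1)
  | .emit i .header => write [true, true] <| .goto fun _ => .increment i .header
  | .emit i .check => .goto fun _ => .literal i 0 false true
  | .emit i .first => .goto fun _ => .walk i .first
  | .emit i .second => .goto fun _ => .walk i .second
  | .walk i κ =>
    .pop .column (fun v o => (o, v.2)) <|
    .branch (fun v => v.1.isSome)
      (.pop .word (fun v o => (v.1, o)) <| .push .wordRead (fun v => v.digit) <|
        .goto fun _ => .walk i κ)
      (.peek .word (fun v o => (v.1, o)) <| .push .out (fun v => S.fits i v.digit false) <|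
        .push .out (fun v => S.fits i v.digit true) <| write [false, false] <|
        .goto fun _ => .back i κ)
  | .back i κ =>
    .pop .wordRead (fun v o => (v.1, o)) <|
    .branch (fun v => v.2.isSome)
      (.push .word (fun v => v.digit) <| .push .column (fun _ => true) <|
        .goto fun _ => .back i κ)
      (.goto fun _ => .increment i κ)
  | .literal i k sat ok =>
    .pop .formula (fun v o => (o, v.2)) <|
    .branch (fun v => v.1.isNone) (.goto fun _ => .rewind i ok) <|
    .push .formulaRead (fun v => v.bit) <|
    .branch (fun v => v.bit)
      (.pop .word (fun v o => (v.1, o)) <| .push .wordRead (fun v => v.digit) <|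
        .goto fun _ => .literal i k sat ok)
      (.goto fun _ => .sign i k sat ok)
  | .sign i k sat ok =>
    .pop .formula (fun v o => (o, v.2)) <|
    .push .formulaRead (fun v => v.bit) <|
    .peek .word (fun v o => (v.1, o)) <|
    .goto fun v => .unread i k (sat || S.fits i v.digit v.bit) ok
  | .unread i k sat ok =>
    .pop .wordRead (fun v o => (v.1, o)) <|
    .branch (fun v => v.2.isSome)
      (.push .word (fun v => v.digit) <| .goto fun _ => .unread i k sat ok)
      (.goto fun _ =>
        if k = 2 then .literal i 0 false (ok && sat) else .literal i (k + 1) sat ok)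
  | .rewind i ok =>
    .pop .formulaRead (fun v o => (o, v.2)) <|
    .branch (fun v => v.1.isSome)
      (.push .formula (fun v => v.bit) <| .goto fun _ => .rewind i ok)
      (write [ok, ok, true, true] <| .goto fun _ => .increment i .check)
  | .increment i κ =>
    .pop .word (fun v o => (v.1, o)) <|
    .branch (fun v => v.2.isNone) (.goto fun _ => .carry i κ true) <|
    .branch (fun v => S.active i v.digit.1)
      (.branch (fun v => v.digit.2)
        (.push .wordRead (fun v => (v.digit.1, false)) <| .goto fun _ => .increment i κ)
        (.push .word (fun v => (v.digit.1, true)) <| .goto fun _ => .carry i κ false))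
      (.push .wordRead (fun v => v.digit) <| .goto fun _ => .increment i κ)
  | .carry i κ overflow =>
    .pop .wordRead (fun v o => (v.1, o)) <|
    .branch (fun v => v.2.isSome)
      (.push .word (fun v => v.digit) <| .goto fun _ => .carry i κ overflow)
      (.goto fun _ => if overflow then .next i κ else .emit i κ)
  | .next i .header => write [false] <| .goto fun _ => .firstColumns i
  | .next i .first => .goto fun _ => .firstColumns i
  | .next i .check => .goto fun _ => .secondColumns i
  | .next i .second => .push .column (fun _ => true) <| .goto fun _ => .secondColumns i
  | .firstColumns i =>
    .pop .column (fun v o => (o, v.2)) <|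
    .branch (fun v => v.1.isSome)
      (.push .columnsDone (fun _ => true) <| .goto fun _ => .emit i .first)
      (.goto fun _ => .emit i .check)
  | .secondColumns i =>
    .pop .columnsDone (fun v o => (o, v.2)) <|
    .branch (fun v => v.1.isSome)
      (.goto fun _ => .emit i .second)
      (.goto fun _ => if h : i.1 + 1 < S.rows then .firstColumns ⟨i.1 + 1, h⟩ else .clean)
  | .clean =>
    .pop .formula (fun v o => (o, v.2)) <|
    .branch (fun v => v.1.isSome) (.goto fun _ => .clean) <|
    .pop .column (fun v o => (o, v.2)) <|
    .branch (fun v => v.1.isSome) (.goto fun _ => .clean) <|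
    .pop .word (fun v o => (v.1, o)) <|
    .branch (fun v => v.2.isSome) (.goto fun _ => .clean) <|
    .halt

/-- The machine that turns a formula into its grid, written in reverse. -/
def machine [NeZero g] : FinTM2 where
  K := Stack
  k₀ := .formula
  k₁ := .out
  Γ := alphabet (ZMod g)
  Λ := Label (ZMod g) (Fin S.rows)
  main := .start
  ΛFin := haveI := ZMod.fintype g; inferInstance
  σ := Register (ZMod g)
  initialState := (none, none)
  σFin := haveI := ZMod.fintype g; inferInstance
  Γk₀Fin := inferInstanceAs (Fintype Bool)
  m := S.code

/-- From the label `l` and the stacks `m` the program gets, whatever the register holds, to the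
label `l'` and the stacks `m'` in at most `t` steps. -/
def Reach (l : Label (ZMod g) (Fin S.rows)) (m : Mem (ZMod g)) (l' : Label (ZMod g) (Fin S.rows))
    (m' : Mem (ZMod g)) (t : ℕ) : Prop :=
  ∀ v : Register (ZMod g), ∃ v', RunsIn (TM2.step S.code) ⟨some l, v, m.stk⟩
    ⟨some l', v', m'.stk⟩ t

namespace Reach

variable {S} {l l' l'' : Label (ZMod g) (Fin S.rows)} {m m' m'' : Mem (ZMod g)} {s t : ℕ}

theorem refl : S.Reach l m l m t := fun v => ⟨v, RunsIn.refl _ _ _⟩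

theorem trans (h : S.Reach l m l' m' s) (h' : S.Reach l' m' l'' m'' t) :
    S.Reach l m l'' m'' (s + t) := fun v => by
  obtain ⟨v', h⟩ := h v
  obtain ⟨v'', h'⟩ := h' v'
  exact ⟨v'', h.trans h'⟩

theorem mono (h : S.Reach l m l' m' s) (hst : s ≤ t) : S.Reach l m l' m' t :=
  fun v => (h v).imp fun _ h => h.mono hst

theorem head (h : ∀ v, ∃ v', TM2.stepAux (S.code l) v m.stk = ⟨some l', v', m'.stk⟩)
    (h' : S.Reach l' m' l'' m'' t) : S.Reach l m l'' m'' (t + 1) := fun v => by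
  obtain ⟨v', h⟩ := h v
  obtain ⟨v'', h'⟩ := h' v'
  exact ⟨v'', RunsIn.head (congrArg some h) h'⟩

theorem single (h : ∀ v, ∃ v', TM2.stepAux (S.code l) v m.stk = ⟨some l', v', m'.stk⟩) :
    S.Reach l m l' m' 1 :=
  head (t := 0) h refl

end Reach

variable {S}

section passes

variable {i : Fin S.rows} {κ : Kind} (m : Mem (ZMod g))

variable (S) in
/-- The four bits written for the digit `x`: the values `2 u` and `2 u + 1` are possible with those
first components that row `i` lets the position of `x` have. -/
def columnBits (i : Fin S.rows) (x : ZMod g × Bool) : List Bool :=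
  [S.fits i x false, S.fits i x true, false, false]

theorem reach_walk (A B X : List (ZMod g × Bool)) (x : ZMod g × Bool) :
    S.Reach
      (.walk i κ) {m with
        word := A ++ x :: B, wordRead := X, column := List.replicate A.length true}
      (.back i κ) {m with
        word := x :: B, wordRead := A.reverse ++ X, column := [],
        out := (S.columnBits i x).reverse ++ m.out}
      (A.length + 1) := by
  induction A generalizing X with
  | nil =>
    refine Reach.single fun v => ?_
    simp [code, stepAux_write, Register.digit, columnBits]
  | cons y A ih =>
    refine Reach.head (fun v => ?_) (by simpa using ih (y :: X))
    simp [code, Register.digit, List.replicate_succ]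

theorem reach_back (w X : List (ZMod g × Bool)) (j : ℕ) :
    S.Reach
      (.back i κ) {m with word := w, wordRead := X, column := List.replicate j true}
      (.increment i κ) {m with
        word := X.reverse ++ w, wordRead := [], column := List.replicate (j + X.length) true}
      (X.length + 1) := by
  induction X generalizing w j with
  | nil =>
    refine Reach.single fun v => ?_
    simp [code]
  | cons y X ih =>
    have rest := ih (y :: w) (j + 1)
    rw [add_assoc, add_comm 1] at rest
    refine Reach.head (fun v => ?_) (by simpa using rest)
    simp [code, Register.digit, List.replicate_succ]

theorem reach_column (hκ : κ = .first ∨ κ = .second) {w : List (ZMod g × Bool)} {j : ℕ}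
    (hj : j < w.length) (F o : List Bool) (k : ℕ) :
    S.Reach (.emit i κ) (.ready F w j k o)
      (.increment i κ) (.ready F w j k ((S.columnBits i w[j]).reverse ++ o)) (2 * j + 3) := by
  have word_eq : w.take j ++ w[j] :: w.drop (j + 1) = w := by
    rw [List.getElem_cons_drop, List.take_append_drop]
  have length_take : (w.take j).length = j := by simp; omega
  have walk := reach_walk (i := i) (κ := κ) (.ready F w j k o) (w.take j) (w.drop (j + 1)) [] w[j]
  have back := reach_back (i := i) (κ := κ)
    (.ready F w j k ((S.columnBits i w[j]).reverse ++ o))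
    (w[j] :: w.drop (j + 1)) (w.take j).reverse 0
  simp only [Mem.ready, word_eq, length_take, List.append_nil, List.reverse_reverse,
    List.length_reverse, zero_add, List.replicate_zero] at walk back
  refine (Reach.head (fun v => ?_) (walk.trans back)).mono (by omega)
  rcases hκ with rfl | rfl <;> simp [code, Mem.ready]

variable {k : Fin 3} {sat ok : Bool}

theorem reach_sign (A B X : List (ZMod g × Bool)) (x : ZMod g × Bool) (a : Bool)
    (F F' : List Bool) :
    S.Reach
      (.literal i k sat ok) {m with
        formula := List.replicate A.length true ++ [false, a] ++ F, formulaRead := F',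
        word := A ++ x :: B, wordRead := X}
      (.unread i k (sat || S.fits i x a) ok) {m with
        formula := F, formulaRead := (List.replicate A.length true ++ [false, a]).reverse ++ F',
        word := x :: B, wordRead := A.reverse ++ X}
      (A.length + 2) := by
  induction A generalizing X F' with
  | nil =>
    refine Reach.head (l' := .sign i k sat ok) (m' := {m with
      formula := a :: F, formulaRead := false :: F', word := x :: B, wordRead := X})
      (fun v => ?_) (Reach.single fun v => ?_)
    · simp [code, Register.bit]
    · simp [code, Register.bit, Register.digit]
  | cons y A ih =>
    have rest := ih (y :: X) (true :: F')
    refine Reach.head (fun v => ?_) (by simpa [replicate_append_cons_self] using rest)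
    simp [code, Register.digit, Register.bit, List.replicate_succ]

variable (S) in
/-- The label after the literal `k` of a clause. -/
def afterLiteral (i : Fin S.rows) (k : Fin 3) (sat ok : Bool) : Label (ZMod g) (Fin S.rows) :=
  if k = 2 then .literal i 0 false (ok && sat) else .literal i (k + 1) sat ok

theorem reach_unread (w X : List (ZMod g × Bool)) :
    S.Reach (.unread i k sat ok) {m with word := w, wordRead := X}
      (S.afterLiteral i k sat ok) {m with word := X.reverse ++ w, wordRead := []}
      (X.length + 1) := by
  induction X generalizing w with
  | nil =>
    refine Reach.single fun v => ?_
    simp [code, afterLiteral]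
  | cons y X ih =>
    refine Reach.head (fun v => ?_) (by simpa using ih (y :: w))
    simp [code, Register.digit]

theorem reach_rewind (F F' : List Bool) :
    S.Reach (.rewind i ok) {m with formula := F, formulaRead := F'}
      (.increment i .check) {m with
        formula := F'.reverse ++ F, formulaRead := [], out := [true, true, ok, ok] ++ m.out}
      (F'.length + 1) := by
  induction F' generalizing F with
  | nil =>
    refine Reach.single fun v => ?_
    simp [code, stepAux_write]
  | cons a F' ih =>
    refine Reach.head (fun v => ?_) (by simpa using ih (a :: F))
    simp [code, Register.bit]

end passes

section check

variable (S) (i : Fin S.rows) (w : List (ZMod g × Bool)) {n : ℕ}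

/-- Whether row `i` admits that the literal `l` is true, if the digits are `w`. It does so for every
literal whose variable it does not see. -/
def admitsLiteral (l : Fin n × Bool) : Bool :=
  S.fits i (w[(l.1 : ℕ)]?.getD (0, false)) l.2

/-- Whether row `i` admits that the clause `cl` is true, if the digits are `w`. -/
def admitsClause (cl : Fin 3 → Fin n × Bool) : Bool :=
  S.admitsLiteral i w (cl 0) || S.admitsLiteral i w (cl 1) || S.admitsLiteral i w (cl 2)

/-- The four bits written in the check column when the digits are `w`: the odd value is always
possible, the even one only if no clause is seen to be false. -/
def checkBits (cls : List (Fin 3 → Fin n × Bool)) : List Bool :=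
  [cls.all (S.admitsClause i w), cls.all (S.admitsClause i w), true, true]

/-- The code of a clause. -/
def clauseCode (cl : Fin 3 → Fin n × Bool) : List Bool :=
  (List.finRange 3).flatMap fun k => ThreeCNF.encodeLiteral (cl k)

theorem clauseCode_eq_append (cl : Fin 3 → Fin n × Bool) :
    clauseCode cl = ThreeCNF.encodeLiteral (cl 0) ++ (ThreeCNF.encodeLiteral (cl 1) ++
      ThreeCNF.encodeLiteral (cl 2)) := by
  simp [clauseCode, List.finRange_succ]

variable {S i w} (m : Mem (ZMod g)) (F F' : List Bool) (hn : n ≤ w.length)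
include hn

theorem reach_literal {k : Fin 3} {sat ok : Bool} (l : Fin n × Bool) :
    S.Reach
      (.literal i k sat ok) {m with
        formula := ThreeCNF.encodeLiteral l ++ F, formulaRead := F', word := w, wordRead := []}
      (S.afterLiteral i k (sat || S.admitsLiteral i w l) ok) {m with
        formula := F, formulaRead := (ThreeCNF.encodeLiteral l).reverse ++ F',
        word := w, wordRead := []}
      (2 * (ThreeCNF.encodeLiteral l).length) := by
  obtain ⟨j, a⟩ := l
  have hj : (j : ℕ) < w.length := j.2.trans_le hn
  have word_eq : w.take j ++ w[(j : ℕ)] :: w.drop (j + 1) = w := by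
    rw [List.getElem_cons_drop, List.take_append_drop]
  have length_take : (w.take (j : ℕ)).length = j := by simp; omega
  have admits_eq : S.admitsLiteral i w (j, a) = S.fits i w[(j : ℕ)] a := by
    simp [admitsLiteral, List.getElem?_eq_getElem hj]
  have sign := reach_sign (i := i) (k := k) (sat := sat) (ok := ok) m (w.take j) (w.drop (j + 1)) []
    w[(j : ℕ)] a F F'
  have unread := reach_unread (i := i) (k := k) (sat := sat || S.fits i w[(j : ℕ)] a) (ok := ok)
    {m with formula := F, formulaRead := (ThreeCNF.encodeLiteral (j, a)).reverse ++ F'}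
    (w[(j : ℕ)] :: w.drop (j + 1)) (w.take j).reverse
  rw [word_eq, length_take, List.append_nil] at sign
  rw [List.reverse_reverse, word_eq, List.length_reverse, length_take] at unread
  rw [admits_eq]
  refine (sign.trans unread).mono ?_
  simp only [ThreeCNF.encodeLiteral, List.length_append, List.length_replicate, List.length_cons,
    List.length_nil]
  omega

theorem reach_clause {ok : Bool} (cl : Fin 3 → Fin n × Bool) :
    S.Reach
      (.literal i 0 false ok) {m with
        formula := clauseCode cl ++ F, formulaRead := F', word := w, wordRead := []}
      (.literal i 0 false (ok && S.admitsClause i w cl)) {m with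
        formula := F, formulaRead := (clauseCode cl).reverse ++ F', word := w, wordRead := []}
      (2 * (clauseCode cl).length) := by
  rw [clauseCode_eq_append]
  simp only [List.append_assoc, List.reverse_append, List.length_append]
  exact (((reach_literal m _ F' hn (i := i) (k := 0) (sat := false) (ok := ok) (cl 0)).trans
    (reach_literal m _ _ hn (k := 1) (cl 1))).trans
    (reach_literal m F _ hn (k := 2) (cl 2))).mono (by omega)

theorem reach_clauses {ok : Bool} (cls : List (Fin 3 → Fin n × Bool)) :
    S.Reach
      (.literal i 0 false ok) {m with
        formula := cls.flatMap clauseCode, formulaRead := F', word := w, wordRead := []}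
      (.literal i 0 false (ok && cls.all (S.admitsClause i w))) {m with
        formula := [], formulaRead := (cls.flatMap clauseCode).reverse ++ F',
        word := w, wordRead := []}
      (2 * (cls.flatMap clauseCode).length) := by
  induction cls generalizing ok F' with
  | nil => simpa using Reach.refl
  | cons cl cls ih =>
    simp only [List.flatMap_cons, List.all_cons, List.reverse_append, List.append_assoc,
      List.length_append, ← Bool.and_assoc]
    exact ((reach_clause m _ _ hn cl).trans (ih _)).mono (by omega)

theorem reach_check (cls : List (Fin 3 → Fin n × Bool)) (j k : ℕ) (o : List Bool) :
    S.Reach (.emit i .check) (.ready (cls.flatMap clauseCode) w j k o)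
      (.increment i .check)
      (.ready (cls.flatMap clauseCode) w j k ((S.checkBits i w cls).reverse ++ o))
      (3 * (cls.flatMap clauseCode).length + 3) := by
  have read := reach_clauses (S := S) (i := i) (.ready [] w j k o) [] hn (ok := true) cls
  have rewind := reach_rewind (i := i) (ok := cls.all (S.admitsClause i w)) (.ready [] w j k o) []
    (cls.flatMap clauseCode).reverse
  simp only [Mem.ready, List.append_nil, Bool.true_and, List.reverse_reverse,
    List.length_reverse] at read rewind
  refine (Reach.head (fun v => ?_) (read.trans (Reach.head (fun v => ?_) rewind))).mono (by omega)
  · simp [code, Mem.ready]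
  · simp [code]

end check

section enumerate

variable {i : Fin S.rows} {κ : Kind} (m : Mem (ZMod g))

theorem reach_increment (G : List (ZMod g)) (X : List (ZMod g × Bool)) {u : ℕ}
    (hu : u < 2 ^ G.countP (S.active i)) :
    ∃ w X' : List (ZMod g × Bool),
      X'.reverse ++ w = X.reverse ++ spreadDigits (S.active i) G (u + 1) ∧
      X'.length ≤ X.length + G.length ∧
      S.Reach (.increment i κ) {m with word := spreadDigits (S.active i) G u, wordRead := X}
        (.carry i κ (decide (u + 1 = 2 ^ G.countP (S.active i))))
        {m with word := w, wordRead := X'} (G.length + 1) := by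
  induction G generalizing X u with
  | nil =>
    obtain rfl : u = 0 := by simpa using hu
    refine ⟨[], X, by simp [spreadDigits], by simp, Reach.single fun v => ?_⟩
    simp [code, spreadDigits]
  | cons x G ih =>
    by_cases hx : S.active i x = true
    · rw [List.countP_cons_of_pos hx, pow_succ] at hu ⊢
      rcases Nat.even_or_odd' u with ⟨u, rfl | rfl⟩
      · refine ⟨(x, true) :: spreadDigits (S.active i) G u, X, ?_, by simp, ?_⟩
        · simp [spreadDigits, hx, show (2 * u + 1) / 2 = u by omega]
        · rw [decide_eq_false (by omega)]
          refine (Reach.single fun v => ?_).mono (Nat.le_add_left 1 _)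
          simp [code, spreadDigits, hx, Register.digit]
      · obtain ⟨w, X', append_eq, length_le, reach⟩ :=
          ih ((x, false) :: X) (u := u) (by omega)
        refine ⟨w, X', ?_, ?_, ?_⟩
        · rw [append_eq]
          simp [spreadDigits, hx, show (2 * u + 1 + 1) / 2 = u + 1 by omega,
            show (2 * u + 1 + 1) % 2 = 0 by omega]
        · simp only [List.length_cons] at length_le ⊢; omega
        · rw [decide_eq_decide.2 (show 2 * u + 1 + 1 = 2 ^ G.countP (S.active i) * 2 ↔
            u + 1 = 2 ^ G.countP (S.active i) by omega)]
          refine Reach.head (fun v => ?_) reach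
          simp [code, spreadDigits, hx, Register.digit, show (2 * u + 1) / 2 = u by omega]
    · rw [List.countP_cons_of_neg hx] at hu ⊢
      obtain ⟨w, X', append_eq, length_le, reach⟩ := ih ((x, false) :: X) hu
      refine ⟨w, X', ?_, ?_, Reach.head (fun v => ?_) reach⟩
      · rw [append_eq]
        simp [spreadDigits, hx]
      · simp only [List.length_cons] at length_le ⊢; omega
      · simp [code, spreadDigits, hx, Register.digit]

theorem reach_carry (w X : List (ZMod g × Bool)) (overflow : Bool) :
    S.Reach (.carry i κ overflow) {m with word := w, wordRead := X}
      (if overflow then .next i κ else .emit i κ)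
      {m with word := X.reverse ++ w, wordRead := []} (X.length + 1) := by
  induction X generalizing w with
  | nil =>
    refine Reach.single fun v => ?_
    simp [code]
  | cons y X ih =>
    refine Reach.head (fun v => ?_) (by simpa using ih (y :: w))
    simp [code, Register.digit]

variable (G : List (ZMod g)) (F o : List Bool) {j k : ℕ}

theorem reach_spreadDigits_succ {u : ℕ} (hu : u < 2 ^ G.countP (S.active i)) :
    S.Reach (.increment i κ) (.ready F (spreadDigits (S.active i) G u) j k o)
      (if u + 1 = 2 ^ G.countP (S.active i) then .next i κ else .emit i κ)
      (.ready F (spreadDigits (S.active i) G (u + 1)) j k o) (2 * G.length + 2) := by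
  obtain ⟨w, X, append_eq, length_le, increment⟩ := reach_increment (κ := κ)
    (.ready F (spreadDigits (S.active i) G u) j k o) G [] hu
  have carry := reach_carry (i := i) (κ := κ) (.ready F (spreadDigits (S.active i) G u) j k o)
    w X (decide (u + 1 = 2 ^ G.countP (S.active i)))
  rw [append_eq] at carry
  simp only [decide_eq_true_eq, List.reverse_nil, List.nil_append] at carry
  refine (increment.trans carry).mono ?_
  rw [List.length_nil] at length_le
  omega

theorem reach_enumerate (bits : ℕ → List Bool) (t : ℕ)
    (hbits : ∀ u < 2 ^ G.countP (S.active i), ∀ o : List Bool,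
      S.Reach (.emit i κ) (.ready F (spreadDigits (S.active i) G u) j k o)
        (.increment i κ)
        (.ready F (spreadDigits (S.active i) G u) j k ((bits u).reverse ++ o)) t) :
    S.Reach (.emit i κ) (.ready F (spreadDigits (S.active i) G 0) j k o)
      (.next i κ) (.ready F (spreadDigits (S.active i) G 0) j k
        (((List.range (2 ^ G.countP (S.active i))).flatMap bits).reverse ++ o))
      (2 ^ G.countP (S.active i) * (t + (2 * G.length + 2))) := by
  have values_le : ∀ u < 2 ^ G.countP (S.active i),
      S.Reach (.emit i κ) (.ready F (spreadDigits (S.active i) G 0) j k o)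
        (if u + 1 = 2 ^ G.countP (S.active i) then .next i κ else .emit i κ)
        (.ready F (spreadDigits (S.active i) G (u + 1)) j k
          (((List.range (u + 1)).flatMap bits).reverse ++ o))
        ((u + 1) * (t + (2 * G.length + 2))) := by
    intro u hu
    induction u with
    | zero => simpa using (hbits 0 hu o).trans (reach_spreadDigits_succ G F _ hu)
    | succ u ih =>
      have previous := ih (by omega)
      rw [if_neg (by omega)] at previous
      rw [List.range_succ (n := u + 1), List.flatMap_append, List.reverse_append,
        List.flatMap_singleton, List.append_assoc]
      exact ((previous.trans (hbits (u + 1) hu _)).trans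
        (reach_spreadDigits_succ G F _ hu)).mono (le_of_eq (by ring))
  have pos : 0 < 2 ^ G.countP (S.active i) := by positivity
  have all := values_le (2 ^ G.countP (S.active i) - 1) (by omega)
  rwa [Nat.sub_add_cancel pos, if_pos rfl, spreadDigits_two_pow] at all

end enumerate

section rows

variable (S) (i : Fin S.rows) (G : List (ZMod g)) {n : ℕ} (cls : List (Fin 3 → Fin n × Bool))

/-- The code of the cell of row `i` in the two columns of position `j`. -/
def columnCell (j : ℕ) : List Bool :=
  (List.range (2 ^ G.countP (S.active i))).flatMap fun u =>
    S.columnBits i ((spreadDigits (S.active i) G u)[j]?.getD (0, false))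

/-- The code of the cell of row `i` in the check column. -/
def checkCell : List Bool :=
  (List.range (2 ^ G.countP (S.active i))).flatMap fun u =>
    S.checkBits i (spreadDigits (S.active i) G u) cls

/-- The code of row `i`: the columns of the positions in decreasing order, the check column, the
columns of the positions in increasing order. -/
def rowBits : List Bool :=
  (List.range G.length).reverse.flatMap (S.columnCell i G) ++ S.checkCell i G cls ++
    (List.range G.length).flatMap (S.columnCell i G)

variable {S i G} (F o : List Bool)

theorem reach_columnCell {κ : Kind} (hκ : κ = .first ∨ κ = .second) {j : ℕ} (hj : j < G.length)
    (k : ℕ) :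
    S.Reach (.emit i κ) (.ready F (spreadDigits (S.active i) G 0) j k o)
      (.next i κ)
      (.ready F (spreadDigits (S.active i) G 0) j k ((S.columnCell i G j).reverse ++ o))
      (2 ^ G.countP (S.active i) * (4 * G.length + 5)) := by
  refine (reach_enumerate G F o _ (2 * j + 3) fun u _ o => ?_).mono ?_
  · have hj' : j < (spreadDigits (S.active i) G u).length := by rwa [length_spreadDigits]
    rw [List.getElem?_eq_getElem hj']
    exact reach_column hκ hj' F o k
  · gcongr 2 ^ _ * ?_
    omega

theorem reach_checkCell (hn : n ≤ G.length) (j k : ℕ) :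
    S.Reach (.emit i .check)
      (.ready (cls.flatMap clauseCode) (spreadDigits (S.active i) G 0) j k o)
      (.next i .check)
      (.ready (cls.flatMap clauseCode) (spreadDigits (S.active i) G 0) j k
        ((S.checkCell i G cls).reverse ++ o))
      (2 ^ G.countP (S.active i) * (3 * (cls.flatMap clauseCode).length + 2 * G.length + 5)) := by
  refine (reach_enumerate G _ o _ (3 * (cls.flatMap clauseCode).length + 3) fun u _ o => ?_).mono ?_
  · exact reach_check (by rwa [length_spreadDigits]) cls j k o
  · gcongr 2 ^ _ * ?_
    omega

theorem reach_firstColumns {j : ℕ} (k : ℕ) (hj : j ≤ G.length) :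
    S.Reach (.firstColumns i) (.ready F (spreadDigits (S.active i) G 0) j k o)
      (.emit i .check)
      (.ready F (spreadDigits (S.active i) G 0) 0 (k + j)
        (((List.range j).reverse.flatMap (S.columnCell i G)).reverse ++ o))
      (j * (2 ^ G.countP (S.active i) * (4 * G.length + 5) + 2) + 1) := by
  induction j generalizing k o with
  | zero =>
    refine (Reach.single fun v => ?_).mono (by omega)
    simp [code, Mem.ready]
  | succ j ih =>
    have column := reach_columnCell (i := i) F o (.inl (rfl : Kind.first = .first))
      (show j < G.length by omega) (k + 1)
    have rest := ih ((S.columnCell i G j).reverse ++ o) (k + 1) (by omega)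
    rw [add_assoc, add_comm 1] at rest
    rw [List.range_succ, List.reverse_append, List.reverse_singleton, List.singleton_append,
      List.flatMap_cons, List.reverse_append, List.append_assoc]
    refine (Reach.head (fun v => ?_) (column.trans (Reach.head (fun v => ?_) rest))).mono
      (le_of_eq (by ring))
    · simp [code, Mem.ready, List.replicate_succ]
    · simp [code]

theorem reach_secondColumns {j k : ℕ} (hjk : j + k ≤ G.length) :
    S.Reach (.secondColumns i) (.ready F (spreadDigits (S.active i) G 0) j k o)
      (.secondColumns i)
      (.ready F (spreadDigits (S.active i) G 0) (j + k) 0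
        (((List.range' j k).flatMap (S.columnCell i G)).reverse ++ o))
      (k * (2 ^ G.countP (S.active i) * (4 * G.length + 5) + 2)) := by
  induction k generalizing j o with
  | zero => simpa using Reach.refl
  | succ k ih =>
    have column := reach_columnCell (i := i) F o (.inr (rfl : Kind.second = .second))
      (show j < G.length by omega) k
    have rest := ih ((S.columnCell i G j).reverse ++ o) (j := j + 1) (by omega)
    rw [add_assoc, add_comm 1] at rest
    rw [List.range'_succ, List.flatMap_cons, List.reverse_append, List.append_assoc]
    refine (Reach.head (fun v => ?_) (column.trans (Reach.head (fun v => ?_) rest))).mono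
      (le_of_eq (by ring))
    · simp [code, Mem.ready, List.replicate_succ]
    · simp [code, Mem.ready, List.replicate_succ]

theorem row_time_le (c m L : ℕ) :
    m * (2 ^ c * (4 * m + 5) + 2) + 1 + 2 ^ c * (3 * L + 2 * m + 5) +
      (m * (2 ^ c * (4 * m + 5) + 2) + 1 + 1) ≤ 10 * 2 ^ c * (m + L + 1) ^ 2 := by
  have one_le : 1 ≤ 2 ^ c := Nat.one_le_two_pow
  nlinarith [Nat.zero_le (2 ^ c * m * L), Nat.zero_le (2 ^ c * L * L), Nat.zero_le (2 ^ c * L),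
    Nat.zero_le (2 ^ c * m * m), Nat.mul_le_mul_right m one_le]

theorem reach_row (hn : n ≤ G.length) :
    S.Reach (.firstColumns i)
      (.ready (cls.flatMap clauseCode) (spreadDigits (S.active i) G 0) G.length 0 o)
      (if h : i.1 + 1 < S.rows then .firstColumns ⟨i.1 + 1, h⟩ else .clean)
      (.ready (cls.flatMap clauseCode) (spreadDigits (S.active i) G 0) G.length 0
        ((S.rowBits i G cls).reverse ++ o))
      (10 * 2 ^ G.countP (S.active i) * (G.length + (cls.flatMap clauseCode).length + 1) ^ 2) := by
  have first := reach_firstColumns (i := i) (cls.flatMap clauseCode) o 0 (le_refl G.length)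
  have check := reach_checkCell (i := i) cls
    (((List.range G.length).reverse.flatMap (S.columnCell i G)).reverse ++ o) hn 0 (0 + G.length)
  have second := reach_secondColumns (i := i) (j := 0) (cls.flatMap clauseCode)
    ((S.checkCell i G cls).reverse ++
      (((List.range G.length).reverse.flatMap (S.columnCell i G)).reverse ++ o))
    (le_of_eq (zero_add G.length))
  rw [zero_add] at first check second
  refine ((first.trans check).trans (Reach.head (fun v => ?_)
    (second.trans (Reach.single fun v => ?_)))).mono (row_time_le _ _ _)
  · simp [code]
  · simp [code, Mem.ready, rowBits, List.range_eq_range']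

theorem reach_rows {c : ℕ} (hc : ∀ i, G.countP (S.active i) = c) (hn : n ≤ G.length) (d k : ℕ)
    (hd : k + d + 1 = S.rows) :
    S.Reach (.firstColumns ⟨k, by omega⟩)
      (.ready (cls.flatMap clauseCode) (G.map fun x => (x, false)) G.length 0 o)
      .clean
      (.ready (cls.flatMap clauseCode) (G.map fun x => (x, false)) G.length 0
        ((((List.finRange S.rows).drop k).flatMap fun i => S.rowBits i G cls).reverse ++ o))
      ((d + 1) * (10 * 2 ^ c * (G.length + (cls.flatMap clauseCode).length + 1) ^ 2)) := by
  have row (k : ℕ) (hk : k < S.rows) (o : List Bool) := reach_row (S := S) (i := ⟨k, hk⟩) cls o hn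
  simp only [hc, spreadDigits_zero] at row
  induction d generalizing k o with
  | zero =>
    have last := row k (by omega) o
    rw [dif_neg (by omega)] at last
    rw [List.drop_eq_getElem_cons (by simp; omega), List.drop_eq_nil_of_le (by simp; omega)]
    simpa using last
  | succ d ih =>
    have this_row := row k (by omega) o
    rw [dif_pos (by omega)] at this_row
    rw [List.drop_eq_getElem_cons (by simp; omega)]
    simp only [List.getElem_finRange, List.flatMap_cons, List.reverse_append, List.append_assoc]
    exact (this_row.trans (ih _ (k + 1) (by omega))).mono (le_of_eq (by ring))

end rows

section preparation

variable (F o : List Bool)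

theorem reach_read (n m : ℕ) :
    S.Reach (.read (m : ZMod g))
      (.ready (List.replicate n true ++ false :: F) ((residues g m).map fun x => (x, false)) m 0 o)
      (.pad ((m + n : ℕ) : ZMod g))
      (.ready F ((residues g (m + n)).map fun x => (x, false)) (m + n) 0
        (List.replicate (2 * n) true ++ o)) (n + 1) := by
  induction n generalizing m o with
  | zero =>
    refine Reach.single fun v => ?_
    simp [code, Mem.ready, Register.bit]
  | succ n ih =>
    have rest := ih (true :: true :: o) (m + 1)
    rw [add_assoc, add_comm 1, replicate_append_cons_self, replicate_append_cons_self] at rest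
    refine Reach.head (fun v => ?_) rest
    simp [code, Mem.ready, stepAux_write, Register.bit, List.replicate_succ, residues]

theorem reach_pad {m k n : ℕ} (hk : k < g) (hn : m + k = n) (hg : g ∣ n) :
    S.Reach (.pad (m : ZMod g))
      (.ready F ((residues g m).map fun x => (x, false)) m 0 o)
      (.emit 0 .header)
      (.ready F ((residues g n).map fun x => (x, false)) n 0
        (false :: List.replicate (2 * k + 1) true ++ o)) (k + 1) := by
  induction k generalizing m o with
  | zero =>
    obtain rfl : m = n := by simpa using hn
    have natCast_eq : (m : ZMod g) = 0 := (ZMod.natCast_eq_zero_iff m g).2 hg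
    refine Reach.single fun v => ?_
    simp [code, Mem.ready, stepAux_write, natCast_eq]
  | succ k ih =>
    have natCast_ne : (m : ZMod g) ≠ 0 := fun h => by
      have dvd_succ : g ∣ k + 1 :=
        (Nat.dvd_add_right ((ZMod.natCast_eq_zero_iff m g).1 h)).1 (hn ▸ hg)
      exact absurd (Nat.le_of_dvd k.succ_pos dvd_succ) (by omega)
    have rest := ih (true :: true :: o) (m := m + 1) (by omega) (by omega)
    rw [List.cons_append, replicate_append_cons_self, replicate_append_cons_self] at rest
    refine Reach.head (fun v => ?_) rest
    simp [code, Mem.ready, stepAux_write, natCast_ne, List.replicate_succ, residues]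

theorem flatMap_range_true_true (n : ℕ) :
    ((List.range n).flatMap fun _ => [true, true]) = List.replicate (2 * n) true := by
  induction n with
  | zero => rfl
  | succ n ih => rw [List.range_succ, List.flatMap_append, ih, mul_add, List.replicate_add]; rfl

theorem reach_header (G : List (ZMod g)) (i : Fin S.rows) (j k : ℕ) :
    S.Reach (.emit i .header) (.ready F (G.map fun x => (x, false)) j k o)
      (.firstColumns i) (.ready F (G.map fun x => (x, false)) j k
        (false :: List.replicate (2 * 2 ^ G.countP (S.active i)) true ++ o))
      (2 ^ G.countP (S.active i) * (2 * G.length + 3) + 1) := by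
  have values := reach_enumerate (i := i) (κ := .header) (j := j) (k := k) G F o
    (fun _ => [true, true]) 1
    (fun u _ o => Reach.single fun v => by simp [code, Mem.ready, stepAux_write])
  rw [flatMap_range_true_true, List.reverse_replicate, spreadDigits_zero] at values
  refine (values.trans (Reach.single fun v => ?_)).mono (le_of_eq (by ring))
  simp [code, Mem.ready, stepAux_write]

end preparation

theorem runsIn_clean (F o : List Bool) (w : List (ZMod g × Bool)) (j : ℕ) (v : Register (ZMod g)) :
    RunsIn (TM2.step S.code) ⟨some .clean, v, (Mem.ready F w j 0 o).stk⟩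
      ⟨none, (none, none), (Mem.ready [] [] 0 0 o).stk⟩ (F.length + j + w.length + 1) := by
  have head : ∀ {c : TM2.Cfg (alphabet (ZMod g)) (Label (ZMod g) (Fin S.rows)) (Register (ZMod g))}
      {v v' : Register (ZMod g)} {m m' : Mem (ZMod g)} {t : ℕ},
      TM2.stepAux (S.code .clean) v m.stk = ⟨some .clean, v', m'.stk⟩ →
      RunsIn (TM2.step S.code) ⟨some .clean, v', m'.stk⟩ c t →
      RunsIn (TM2.step S.code) ⟨some .clean, v, m.stk⟩ c (t + 1) :=
    fun h h' => RunsIn.head (congrArg some h) h'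
  induction F generalizing v with
  | cons a F ih =>
    refine (head ?_ (ih (some a, v.2))).mono (by rw [List.length_cons]; omega)
    simp [code, Mem.ready]
  | nil =>
    induction j generalizing v with
    | succ j ih =>
      refine (head ?_ (ih (some true, v.2))).mono (by omega)
      simp [code, Mem.ready, List.replicate_succ]
    | zero =>
      induction w generalizing v with
      | cons x w ih =>
        refine (head ?_ (ih (none, some x))).mono (by rw [List.length_cons]; omega)
        simp [code, Mem.ready]
      | nil =>
        refine RunsIn.single (congrArg some ?_)
        simp [code, Mem.ready]

section machine

variable (S)

/-- The code of the grid with `2 * G.length + 1` columns, row by row. -/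
def gridBits (G : List (ZMod g)) {n : ℕ} (cls : List (Fin 3 → Fin n × Bool)) : List Bool :=
  List.replicate S.rows true ++ [false] ++ List.replicate (2 * G.length + 1) true ++ [false] ++
    List.replicate (2 * 2 ^ G.countP (S.active 0)) true ++ [false] ++
    (List.finRange S.rows).flatMap fun i => S.rowBits i G cls

theorem encode_eq_append_clauseCode (φ : ThreeCNF) :
    φ.encode = List.replicate φ.n true ++ false :: φ.clauses.flatMap clauseCode := by
  rw [ThreeCNF.encode, List.append_assoc]
  rfl

variable [NeZero g]

theorem initList_machine (u : List Bool) :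
    initList S.machine u =
      (⟨some .start, (none, none), (Mem.ready u [] 0 0 []).stk⟩ :
        TM2.Cfg (alphabet (ZMod g)) (Label (ZMod g) (Fin S.rows)) (Register (ZMod g))) := by
  refine congrArg (TM2.Cfg.mk _ _) ((initList_stk S.machine u).trans ?_)
  funext k; cases k <;> rfl

theorem haltList_machine (u : List Bool) :
    haltList S.machine u =
      (⟨none, (none, none), (Mem.ready [] [] 0 0 u).stk⟩ :
        TM2.Cfg (alphabet (ZMod g)) (Label (ZMod g) (Fin S.rows)) (Register (ZMod g))) := by
  refine congrArg (TM2.Cfg.mk _ _) ((haltList_stk S.machine u).trans ?_)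
  funext k; cases k <;> rfl

theorem reach_prepared (φ : ThreeCNF) {c : ℕ}
    (hc : (residues g (width g φ.n)).countP (S.active 0) = c) :
    S.Reach .start (.ready φ.encode [] 0 0 [])
      (.firstColumns 0)
      (.ready (φ.clauses.flatMap clauseCode) ((residues g (width g φ.n)).map fun x => (x, false))
        (width g φ.n) 0
        (List.replicate S.rows true ++ [false] ++ List.replicate (2 * width g φ.n + 1) true ++
          [false] ++ List.replicate (2 * 2 ^ c) true ++ [false]).reverse)
      (1 + (φ.n + 1) + (width g φ.n - φ.n + 1) + (2 ^ c * (2 * width g φ.n + 3) + 1)) := by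
  have n_le : φ.n ≤ width g φ.n := le_width φ.n
  have lt_n_add : width g φ.n < φ.n + g := width_lt φ.n
  have start : S.Reach .start (.ready φ.encode [] 0 0 []) (.read 0)
      (.ready φ.encode [] 0 0 (false :: List.replicate S.rows true)) 1 :=
    Reach.single fun v => by simp [code, Mem.ready, stepAux_write]
  have read := reach_read (S := S) (φ.clauses.flatMap clauseCode)
    (false :: List.replicate S.rows true) φ.n 0
  have pad := reach_pad (S := S) (φ.clauses.flatMap clauseCode)
    (List.replicate (2 * φ.n) true ++ false :: List.replicate S.rows true)
    (show width g φ.n - φ.n < g by omega) (Nat.add_sub_cancel' n_le) (Dvd.intro _ rfl)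
  have header := reach_header (S := S) (φ.clauses.flatMap clauseCode)
    (false :: List.replicate (2 * (width g φ.n - φ.n) + 1) true ++
      (List.replicate (2 * φ.n) true ++ false :: List.replicate S.rows true))
    (residues g (width g φ.n)) 0 (width g φ.n) 0
  have columns_eq (l : List Bool) : List.replicate (2 * (width g φ.n - φ.n) + 1) true ++
      (List.replicate (2 * φ.n) true ++ l) = List.replicate (2 * width g φ.n + 1) true ++ l := by
    rw [← List.append_assoc, ← List.replicate_add]
    congr 2
    omega
  rw [encode_eq_append_clauseCode] at start ⊢
  rw [zero_add, Nat.cast_zero] at read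
  rw [hc, length_residues] at header
  have reach := ((start.trans read).trans pad).trans header
  simp only [List.cons_append, columns_eq] at reach
  simpa using reach

theorem preparation_time_le {n m : ℕ} (hnm : n ≤ m) (c L : ℕ) :
    1 + (n + 1) + (m - n + 1) + (2 ^ c * (2 * m + 3) + 1) + (L + m + m + 1) ≤
      10 * 2 ^ c * (m + L + 1) ^ 2 := by
  have one_le : 1 ≤ 2 ^ c := Nat.one_le_two_pow
  have sum_le : m + L + 1 ≤ (m + L + 1) ^ 2 := Nat.le_self_pow two_ne_zero _
  calc 1 + (n + 1) + (m - n + 1) + (2 ^ c * (2 * m + 3) + 1) + (L + m + m + 1)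
      = 2 ^ c * (2 * m + 3) + 1 * (3 * m + L + 5) := by omega
    _ ≤ 2 ^ c * (2 * m + 3) + 2 ^ c * (3 * m + L + 5) := by gcongr
    _ = 2 ^ c * (5 * m + L + 8) := by ring
    _ ≤ 2 ^ c * (10 * (m + L + 1)) := by gcongr; omega
    _ = 10 * 2 ^ c * (m + L + 1) := by ring
    _ ≤ 10 * 2 ^ c * (m + L + 1) ^ 2 := by gcongr

theorem runsIn_machine (φ : ThreeCNF) :
    RunsIn S.machine.step (initList S.machine φ.encode)
      (haltList S.machine (S.gridBits (residues g (width g φ.n)) φ.clauses).reverse)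
      (10 * (S.rows + 1) * 2 ^ numDigits g φ.n *
        (width g φ.n + (φ.clauses.flatMap clauseCode).length + 1) ^ 2) := by
  have n_le : φ.n ≤ width g φ.n := le_width φ.n
  have rows_pos : 0 < S.rows := NeZero.pos S.rows
  have prepared := S.reach_prepared φ (S.countP_active 0 φ.n)
  have rows := reach_rows φ.clauses (List.replicate S.rows true ++ [false] ++
      List.replicate (2 * width g φ.n + 1) true ++ [false] ++
      List.replicate (2 * 2 ^ numDigits g φ.n) true ++ [false]).reverse
    (fun i => S.countP_active i φ.n) (by rwa [length_residues]) (S.rows - 1) 0 (by omega)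
  rw [List.drop_zero, ← List.reverse_append, length_residues] at rows
  obtain ⟨v, run⟩ := (prepared.trans rows) (none, none)
  rw [initList_machine, haltList_machine, gridBits, length_residues, S.countP_active 0 φ.n]
  refine (run.trans (runsIn_clean _ _ _ _ v)).mono ?_
  rw [Nat.sub_add_cancel rows_pos, List.length_map, length_residues]
  have remaining_le := preparation_time_le n_le (numDigits g φ.n)
    (φ.clauses.flatMap clauseCode).length
  linarith

end machine

/-! ### The grid -/

/-- The position of variables that the column `j` of `2 * m + 1` columns is about, or `none` for the
check column in the middle. -/
def columnPos (m j : ℕ) : Option ℕ :=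
  if j < m then some (m - 1 - j) else if j = m then none else some (j - (m + 1))

section columnPos

variable {m t : ℕ}

theorem columnPos_left (ht : t < m) : columnPos m (m - 1 - t) = some t := by
  rw [columnPos, if_pos (by omega)]
  congr 1
  omega

theorem columnPos_self : columnPos m m = none := by
  simp [columnPos]

theorem columnPos_right : columnPos m (m + 1 + t) = some t := by
  rw [columnPos, if_neg (by omega), if_neg (by omega), Nat.add_sub_cancel_left]

theorem lt_of_columnPos_eq_some {j : ℕ} (hj : j ≤ 2 * m) (h : columnPos m j = some t) : t < m := by
  simp only [columnPos] at h
  split_ifs at h <;> simp only [Option.some.injEq] at h <;> omega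

theorem flatMap_columnPos {α : Type*} (m : ℕ) (f : Option ℕ → List α) :
    (List.range (2 * m + 1)).flatMap (fun j => f (columnPos m j)) =
      (List.range m).reverse.flatMap (fun t => f (some t)) ++ f none ++
        (List.range m).flatMap fun t => f (some t) := by
  have left : (List.range m).map (columnPos m) = (List.range m).reverse.map some := by
    refine List.ext_getElem (by simp) fun j h _ => ?_
    have hj : j < m := by simpa using h
    simp [columnPos, hj]
  rw [show 2 * m + 1 = m + 1 + m by ring, List.range_add, List.range_succ, List.flatMap_append,
    List.flatMap_append, List.flatMap_singleton, columnPos_self, List.flatMap_map]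
  simp only [columnPos_right]
  rw [← List.flatMap_map (f := columnPos m) (g := f), left, List.flatMap_map]

end columnPos

section cells

variable (S) (i : Fin S.rows) (G : List (ZMod g)) {n : ℕ} (cls : List (Fin 3 → Fin n × Bool))

/-- Whether the pair `(a, v)` belongs to the cell of row `i` in a column of the given position. The
parity of `v` is a flag and `v / 2` is the number whose digits are read. -/
def cellMem : Option ℕ → Bool → ℕ → Bool
  | none, _, v => v % 2 == 1 || cls.all (S.admitsClause i (spreadDigits (S.active i) G (v / 2)))
  | some t, a, v =>
    v % 2 == 0 && S.fits i ((spreadDigits (S.active i) G (v / 2))[t]?.getD (0, false)) a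

/-- The code of the cell of row `i` in a column of the given position. -/
def cellCode (pos : Option ℕ) : List Bool :=
  (List.range (2 * 2 ^ G.countP (S.active i))).flatMap fun v =>
    [S.cellMem i G cls pos false v, S.cellMem i G cls pos true v]

variable {S i G}

theorem cellCode_some (t : ℕ) : S.cellCode i G cls (some t) = S.columnCell i G t := by
  rw [cellCode, flatMap_range_two_mul, columnCell]
  refine congrArg (fun f => List.flatMap f _) (funext fun u => ?_)
  simp [cellMem, columnBits]

theorem cellCode_none : S.cellCode i G cls none = S.checkCell i G cls := by
  rw [cellCode, flatMap_range_two_mul, checkCell]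
  refine congrArg (fun f => List.flatMap f _) (funext fun u => ?_)
  simp [cellMem, checkBits]

theorem flatMap_cellCode :
    (List.range (2 * G.length + 1)).flatMap
      (fun j => S.cellCode i G cls (columnPos G.length j)) = S.rowBits i G cls := by
  rw [flatMap_columnPos, cellCode_none, rowBits]
  simp only [cellCode_some]

end cells

section grid

variable (S)

/-- The grid of a formula. Its values consist of `numDigits g φ.n` binary digits and the flag. -/
def grid (φ : ThreeCNF) : GridTilingInstance where
  x := S.rows
  y := 2 * width g φ.n + 1
  N := 2 * 2 ^ numDigits g φ.n
  x_pos := NeZero.pos S.rows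
  y_pos := Nat.succ_pos _
  S i j := Finset.univ.filter fun e =>
    S.cellMem i (residues g (width g φ.n)) φ.clauses (columnPos (width g φ.n) j) e.1 e.2
  S_nonempty i j := by
    have one_lt : 1 < 2 * 2 ^ numDigits g φ.n := by
      have := Nat.two_pow_pos (numDigits g φ.n)
      omega
    rcases columnPos (width g φ.n) j with _ | t
    · exact ⟨(false, ⟨1, one_lt⟩), Finset.mem_filter.2 ⟨Finset.mem_univ _, rfl⟩⟩
    · refine ⟨(S.negated i, ⟨0, by omega⟩), Finset.mem_filter.2 ⟨Finset.mem_univ _, ?_⟩⟩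
      simp only [cellMem, spreadDigits_zero, Nat.zero_div, fits, List.getElem?_map]
      rcases (residues g (width g φ.n))[t]? with _ | x <;> simp

variable {S}

theorem mem_grid {φ : ThreeCNF} (i : Fin S.rows) (j : Fin (2 * width g φ.n + 1))
    (e : Bool × Fin (2 * 2 ^ numDigits g φ.n)) :
    e ∈ (S.grid φ).S i j ↔ S.cellMem i (residues g (width g φ.n)) φ.clauses
      (columnPos (width g φ.n) j) e.1 e.2 = true :=
  Finset.mem_filter.trans (and_iff_right (Finset.mem_univ _))

theorem encode_grid [NeZero g] (φ : ThreeCNF) :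
    (S.grid φ).encode = S.gridBits (residues g (width g φ.n)) φ.clauses := by
  have row_eq : ∀ i : Fin S.rows, ((List.finRange (S.grid φ).y).flatMap fun j =>
      (List.finRange (S.grid φ).N).flatMap fun v =>
        [decide ((false, v) ∈ (S.grid φ).S i j), decide ((true, v) ∈ (S.grid φ).S i j)]) =
      S.rowBits i (residues g (width g φ.n)) φ.clauses := by
    intro i
    rw [← flatMap_cellCode, length_residues, ← flatMap_finRange]
    refine congrArg (fun f => List.flatMap f _) (funext fun j => ?_)
    rw [cellCode, S.countP_active, ← flatMap_finRange]
    refine congrArg (fun f => List.flatMap f _) (funext fun v => ?_)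
    have decide_eq : ∀ a : Bool, decide ((a, v) ∈ (S.grid φ).S i j) = S.cellMem i
        (residues g (width g φ.n)) φ.clauses (columnPos (width g φ.n) j) a v := fun a =>
      Bool.eq_iff_iff.2 (decide_eq_true_iff.trans (mem_grid i j _))
    exact congrArg₂ (fun a a' => [a, a']) (decide_eq false) (decide_eq true)
  rw [GridTilingInstance.encode, gridBits, length_residues, S.countP_active]
  exact congrArg₂ _ rfl (congrArg (fun f => List.flatMap f _) (funext row_eq))

end grid

section tiling

variable (S)

/-- Row `i` of the grid of `φ` is solved by the first components `a` of the columns and the values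
`B`, which continue beyond the last column. -/
structure IsRowTiling (φ : ThreeCNF) (i : Fin S.rows) (a : ℕ → Bool) (B : ℕ → ℕ) : Prop where
  monotone : Monotone B
  lt : ∀ j, B j < 2 * 2 ^ numDigits g φ.n
  mem : ∀ j ≤ 2 * width g φ.n, S.cellMem i (residues g (width g φ.n)) φ.clauses
    (columnPos (width g φ.n) j) (a j) (B j) = true

variable {S} {φ : ThreeCNF}

theorem exists_isRowTiling (h : (S.grid φ).MonotoneSolvable) :
    ∃ (a : ℕ → Bool) (B : Fin S.rows → ℕ → ℕ), ∀ i, S.IsRowTiling φ i a (B i) := by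
  obtain ⟨(s : Fin S.rows → Fin (2 * width g φ.n + 1) → Bool × Fin (2 * 2 ^ numDigits g φ.n)),
    s_mem, column_eq, row_le⟩ := h
  let clamp (j : ℕ) : Fin (2 * width g φ.n + 1) :=
    ⟨min j (2 * width g φ.n), Nat.lt_succ_of_le (min_le_right _ _)⟩
  have clamp_of_le {j : ℕ} (hj : j ≤ 2 * width g φ.n) : (clamp j : ℕ) = j := min_eq_left hj
  have first_eq (j : ℕ) (i : Fin S.rows) : (s i (clamp j)).1 = (s 0 (clamp j)).1 := by
    obtain ⟨k, hk⟩ := i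
    induction k with
    | zero => rfl
    | succ k ih =>
      exact (column_eq ⟨k, Nat.lt_of_succ_lt hk⟩ ⟨k + 1, hk⟩ (clamp j) rfl).symm.trans (ih _)
  refine ⟨fun j => (s 0 (clamp j)).1, fun i j => (s i (clamp j)).2, fun i =>
    ⟨monotone_nat_of_le_succ fun j => ?_, fun j => (s i (clamp j)).2.2, fun j hj => ?_⟩⟩
  · rcases Nat.lt_or_ge j (2 * width g φ.n) with hj | hj
    · exact row_le i _ _ ((clamp_of_le hj).trans (congrArg Nat.succ (clamp_of_le hj.le)).symm)
    · have clamp_succ : clamp (j + 1) = clamp j := Fin.ext (by simp only [clamp]; omega)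
      simp only [clamp_succ, le_refl]
  · have := (mem_grid i (clamp j) _).1 (s_mem i (clamp j))
    rwa [clamp_of_le hj, first_eq] at this

theorem monotoneSolvable_of_isRowTiling {a : ℕ → Bool} {B : Fin S.rows → ℕ → ℕ}
    (h : ∀ i, S.IsRowTiling φ i a (B i)) : (S.grid φ).MonotoneSolvable :=
  ⟨fun i j => (a j, ⟨B i j, (h i).lt j⟩),
    fun i j => (mem_grid i j _).2 ((h i).mem j (Nat.le_of_lt_succ j.2)),
    fun _ _ _ _ => rfl,
    fun i _ _ hj => (h i).monotone (hj ▸ Nat.le_succ _)⟩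

end tiling

section rowValue

variable (S) (i : Fin S.rows) (G : List (ZMod g)) (A : ℕ → Bool)

/-- The number by which row `i` represents the assignment `A`. -/
def rowValue : ℕ := spreadValue (S.active i) G fun t => xor (A t) (S.negated i)

variable {S i G A}

theorem fits_rowValue {t : ℕ} {x : ZMod g} (hx : G[t]? = some x) (a : Bool) :
    S.fits i ((spreadDigits (S.active i) G (S.rowValue i G A))[t]?.getD (0, false)) a = true ↔
      (S.active i x = true → a = A t) := by
  rw [rowValue, getElem?_spreadDigits_spreadValue, hx]
  cases h : S.active i x <;> simp [fits, h]

theorem admitsClause_iff (w : List (ZMod g × Bool)) {n : ℕ} (cl : Fin 3 → Fin n × Bool) :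
    S.admitsClause i w cl = true ↔ ∃ k, S.admitsLiteral i w (cl k) = true := by
  simp [admitsClause, Fin.exists_fin_succ, or_assoc]

theorem admitsClause_rowValue {n m : ℕ} (hn : n ≤ m) (cl : Fin 3 → Fin n × Bool) :
    S.admitsClause i (spreadDigits (S.active i) (residues g m) (S.rowValue i (residues g m) A)) cl
        = true ↔
      ∃ k, S.active i ((residues g m)[((cl k).1 : ℕ)]'(by rw [length_residues]; omega)) = true →
        A (cl k).1 = (cl k).2 := by
  rw [admitsClause_iff]
  refine exists_congr fun k => ?_
  rw [admitsLiteral, fits_rowValue (List.getElem?_eq_getElem (by rw [length_residues]; omega)),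
    @eq_comm _ (cl k).2]

variable (A) in
theorem rowValue_lt [NeZero g] (n : ℕ) :
    S.rowValue i (residues g (width g n)) A < 2 ^ numDigits g n := by
  rw [← S.countP_active i n]
  exact spreadValue_lt _ _

end rowValue

theorem isRowTiling_of_satisfying [NeZero g] {φ : ThreeCNF} {A : ℕ → Bool}
    (hA : ∀ cl ∈ φ.clauses, ∃ k, A (cl k).1 = (cl k).2) (i : Fin S.rows) :
    S.IsRowTiling φ i (fun j => ((columnPos (width g φ.n) j).map A).getD false)
      (fun _ => 2 * S.rowValue i (residues g (width g φ.n)) A) where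
  monotone := monotone_const
  lt _ := by
    have := S.rowValue_lt (i := i) A φ.n
    omega
  mem j hj := by
    rcases hpos : columnPos (width g φ.n) j with _ | t
    · simp only [cellMem, Bool.or_eq_true, List.all_eq_true, Nat.mul_div_cancel_left _ two_pos]
      refine Or.inr fun cl hcl => (admitsClause_rowValue (le_width φ.n) cl).2 ?_
      obtain ⟨k, hk⟩ := hA cl hcl
      exact ⟨k, fun _ => hk⟩
    · have ht : t < (residues g (width g φ.n)).length := by
        rw [length_residues]
        exact lt_of_columnPos_eq_some hj hpos
      simp only [cellMem, Bool.and_eq_true, Nat.mul_mod_right, Nat.mul_div_cancel_left _ two_pos,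
        Option.map_some, Option.getD_some]
      exact ⟨rfl, (fits_rowValue (List.getElem?_eq_getElem ht) _).2 fun _ => rfl⟩

namespace IsRowTiling

variable {φ : ThreeCNF} {i : Fin S.rows} {a : ℕ → Bool} {B : ℕ → ℕ}

theorem spreadDigits_getElem? (h : S.IsRowTiling φ i a B) {j t : ℕ} {x : ZMod g}
    (hj : j ≤ 2 * width g φ.n) (hpos : columnPos (width g φ.n) j = some t)
    (hx : (residues g (width g φ.n))[t]? = some x) (hactive : S.active i x = true) :
    (spreadDigits (S.active i) (residues g (width g φ.n)) (B j / 2))[t]? =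
      some (x, xor (a j) (S.negated i)) := by
  have cell := h.mem j hj
  obtain ⟨⟨y, d⟩, digit_eq, rfl⟩ := Option.map_eq_some_iff.1
    ((map_fst_getElem?_spreadDigits (active := S.active i) _ (B j / 2) t).trans hx)
  rw [hpos, cellMem, digit_eq] at cell
  simp only [Option.getD_some, fits, hactive, Bool.not_true, Bool.false_or, Bool.and_eq_true,
    beq_iff_eq] at cell
  rw [digit_eq, cell.2]
  simp

theorem rowValue_le (h : S.IsRowTiling φ i a B) :
    S.rowValue i (residues g (width g φ.n)) (fun t => a (width g φ.n - 1 - t)) ≤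
      B (width g φ.n) / 2 := by
  have digits : HasDigits (S.active i) (residues g (width g φ.n))
      (fun t => B (width g φ.n - 1 - t) / 2)
      (fun t => xor (a (width g φ.n - 1 - t)) (S.negated i)) := fun t x hx hactive => by
    have ht : t < width g φ.n := by
      simpa [length_residues] using (List.getElem?_eq_some_iff.1 hx).1
    exact h.spreadDigits_getElem? (by omega) (columnPos_left ht) hx hactive
  refine (digits.spreadValue_le fun s t hst => Nat.div_le_div_right (h.monotone ?_)).trans
    (Nat.div_le_div_right (h.monotone ?_)) <;> omega

theorem le_rowValue [NeZero g] (h : S.IsRowTiling φ i a B) :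
    B (width g φ.n + 1) / 2 ≤
      S.rowValue i (residues g (width g φ.n)) (fun t => a (width g φ.n + 1 + t)) := by
  have digits : HasDigits (S.active i) (residues g (width g φ.n))
      (fun t => B (width g φ.n + 1 + t) / 2)
      (fun t => xor (a (width g φ.n + 1 + t)) (S.negated i)) := fun t x hx hactive => by
    have ht : t < width g φ.n := by
      simpa [length_residues] using (List.getElem?_eq_some_iff.1 hx).1
    exact h.spreadDigits_getElem? (by omega) columnPos_right hx hactive
  refine digits.le_spreadValue
    (fun s t hst => Nat.div_le_div_right (h.monotone (by omega))) fun t => ?_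
  rw [S.countP_active]
  exact Nat.div_lt_of_lt_mul (h.lt _)

theorem even_right (h : S.IsRowTiling φ i a B) (hm : 0 < width g φ.n) :
    B (width g φ.n + 1) % 2 = 0 := by
  have cell := h.mem (width g φ.n + 1) (by omega)
  rw [← Nat.add_zero (width g φ.n + 1), columnPos_right, cellMem, Bool.and_eq_true] at cell
  exact beq_iff_eq.1 cell.1

variable {i' : Fin S.rows} {B' : ℕ → ℕ}

/- Row `i` bounds the value of the assignment on the left by that of the assignment on the right,
and row `i'`, which sees the complements, bounds it the other way round. -/
theorem eq_two_mul_rowValue [NeZero g] (h : S.IsRowTiling φ i a B) (h' : S.IsRowTiling φ i' a B')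
    (hgroups : S.groups i' = S.groups i) (hi : S.negated i = false) (hi' : S.negated i' = true)
    (hm : 0 < width g φ.n) :
    B (width g φ.n) =
      2 * S.rowValue i (residues g (width g φ.n)) (fun t => a (width g φ.n - 1 - t)) := by
  have active_eq : S.active i' = S.active i := by
    unfold active
    rw [hgroups]
  have left := h.rowValue_le
  have right := h.le_rowValue
  have left' := h'.rowValue_le
  have right' := h'.le_rowValue
  have middle : B (width g φ.n) ≤ B (width g φ.n + 1) := h.monotone (Nat.le_succ _)
  have middle' : B' (width g φ.n) ≤ B' (width g φ.n + 1) := h'.monotone (Nat.le_succ _)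
  have even := h.even_right hm
  simp only [rowValue, active_eq, hi, hi', Bool.xor_false, Bool.xor_true]
    at left right left' right' ⊢
  have complement_left := spreadValue_add_spreadValue_not (active := S.active i)
    (residues g (width g φ.n)) (fun t => a (width g φ.n - 1 - t))
  have complement_right := spreadValue_add_spreadValue_not (active := S.active i)
    (residues g (width g φ.n)) (fun t => a (width g φ.n + 1 + t))
  omega

end IsRowTiling

theorem satisfiable_of_isRowTiling [NeZero g] {φ : ThreeCNF} {a : ℕ → Bool}
    {B : Fin S.rows → ℕ → ℕ} (h : ∀ i, S.IsRowTiling φ i a (B i)) : φ.Satisfiable := by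
  refine ⟨fun v => a (width g φ.n - 1 - v), fun cl hcl => ?_⟩
  have hm : 0 < width g φ.n := (Nat.zero_le _).trans_lt ((cl 0).1.2.trans_le (le_width φ.n))
  obtain ⟨i, i', groups_eq, hi, hi', covers⟩ := S.exists_covering fun k =>
    (residues g (width g φ.n))[((cl k).1 : ℕ)]'(by
      rw [length_residues]; exact (cl k).1.2.trans_le (le_width φ.n))
  have check := (h i).mem (width g φ.n) (by omega)
  rw [(h i).eq_two_mul_rowValue (h i') groups_eq hi hi' hm, columnPos_self, cellMem,
    Nat.mul_mod_right, Nat.mul_div_cancel_left _ two_pos] at check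
  simp only [Nat.zero_ne_one, beq_iff_eq, Bool.or_eq_true, false_or, List.all_eq_true] at check
  obtain ⟨k, hk⟩ := (admitsClause_rowValue (le_width φ.n) cl).1 (check cl hcl)
  exact ⟨k, hk (decide_eq_true (covers k))⟩

theorem monotoneSolvable_grid_iff [NeZero g] (φ : ThreeCNF) :
    (S.grid φ).MonotoneSolvable ↔ φ.Satisfiable := by
  constructor
  · intro h
    obtain ⟨a, B, hB⟩ := exists_isRowTiling h
    exact satisfiable_of_isRowTiling hB
  · rintro ⟨A, hA⟩
    let A' : ℕ → Bool := fun t => if h : t < φ.n then A ⟨t, h⟩ else false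
    have hA' : ∀ cl ∈ φ.clauses, ∃ k, A' (cl k).1 = (cl k).2 := fun cl hcl => by
      simpa [A'] using hA cl hcl
    exact monotoneSolvable_of_isRowTiling (isRowTiling_of_satisfying hA')

/-! ### Running times -/

/-- `S.machine` as a machine over the binary alphabet. -/
def writer [NeZero g] (S : RowScheme g) : TM2ComputableAux Bool Bool where
  tm := S.machine
  inputAlphabet := Equiv.refl Bool
  outputAlphabet := Equiv.refl Bool

theorem outputsWithin_writer [NeZero g] (φ : ThreeCNF) :
    OutputsWithin S.writer φ.encode (S.grid φ).encode.reverse (10 * (S.rows + 1) *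
      2 ^ numDigits g φ.n * (width g φ.n + (φ.clauses.flatMap clauseCode).length + 1) ^ 2) := by
  have input : φ.encode.map S.writer.inputAlphabet.symm = φ.encode := List.map_id _
  have output : (S.grid φ).encode.reverse.map S.writer.outputAlphabet.symm =
      (S.grid φ).encode.reverse := List.map_id _
  rw [OutputsWithin, input, output, encode_grid]
  exact S.runsIn_machine φ

section length

variable {n : ℕ} (cl : Fin 3 → Fin n × Bool) (cls : List (Fin 3 → Fin n × Bool))

theorem length_clauseCode_le : (clauseCode cl).length ≤ 3 * (n + 1) := by
  have literal_le (k : Fin 3) : (ThreeCNF.encodeLiteral (cl k)).length ≤ n + 1 := by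
    simp [ThreeCNF.encodeLiteral]
  rw [clauseCode_eq_append, List.length_append, List.length_append]
  linarith [literal_le 0, literal_le 1, literal_le 2]

theorem length_flatMap_clauseCode_le (φ : ThreeCNF) :
    (φ.clauses.flatMap clauseCode).length ≤ 24 * (φ.n + 1) ^ 4 := by
  have clauses_le : φ.clauses.length ≤ (2 * φ.n) ^ 3 := by
    simpa [Fintype.card_pi, mul_comm] using φ.nodup.length_le_card
  calc (φ.clauses.flatMap clauseCode).length
      ≤ φ.clauses.length * (3 * (φ.n + 1)) := by
        rw [List.length_flatMap, ← smul_eq_mul,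
          ← List.length_map fun cl => (clauseCode cl).length]
        refine List.sum_le_card_nsmul _ _ fun l hl => ?_
        obtain ⟨cl, -, rfl⟩ := List.mem_map.1 hl
        exact length_clauseCode_le cl
    _ ≤ (2 * (φ.n + 1)) ^ 3 * (3 * (φ.n + 1)) := by
        refine Nat.mul_le_mul_right _ (clauses_le.trans ?_)
        gcongr
        omega
    _ = 24 * (φ.n + 1) ^ 4 := by ring

theorem length_rowBits (i : Fin S.rows) (G : List (ZMod g)) :
    (S.rowBits i G cls).length = (2 * G.length + 1) * (2 ^ G.countP (S.active i) * 4) := by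
  simp only [rowBits, columnCell, columnBits, checkCell, checkBits, List.length_append,
    List.length_flatMap, List.length_cons, List.length_nil, List.map_const', List.sum_replicate_nat,
    List.length_reverse, List.length_range]
  ring

variable (S) in
theorem length_encode_grid [NeZero g] (φ : ThreeCNF) :
    (S.grid φ).encode.length = S.rows + 2 * width g φ.n + 2 * 2 ^ numDigits g φ.n + 4 +
      S.rows * ((2 * width g φ.n + 1) * (2 ^ numDigits g φ.n * 4)) := by
  simp only [encode_grid, gridBits, length_rowBits, countP_active, length_residues,
    List.length_append, List.length_flatMap, List.length_replicate, List.length_singleton,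
    List.map_const', List.sum_replicate_nat, List.length_finRange]
  ring

end length

variable (S) in
/-- A bound for the time that it takes to write down the grid of a formula with `n` variables. -/
def writingTime (n : ℕ) : ℕ := 20 * (S.rows + 1) * (g + 25) ^ 2 * (2 ^ numDigits g n * (n + 1) ^ 8)

theorem le_writingTime [NeZero g] (φ : ThreeCNF) :
    10 * (S.rows + 1) * 2 ^ numDigits g φ.n *
        (width g φ.n + (φ.clauses.flatMap clauseCode).length + 1) ^ 2 +
      ((S.grid φ).encode.length + 1) ≤ S.writingTime φ.n := by
  rw [length_encode_grid, writingTime]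
  set ℓ := width g φ.n + (φ.clauses.flatMap clauseCode).length + 1 with hℓ
  set D := 2 ^ numDigits g φ.n
  have D_pos : 0 < D := Nat.two_pow_pos _
  have grid_le : S.rows + 2 * width g φ.n + 2 * D + 4 +
      S.rows * ((2 * width g φ.n + 1) * (D * 4)) + 1 ≤ 10 * (S.rows + 1) * D * ℓ ^ 2 := by
    have width_le : width g φ.n + 1 ≤ ℓ := by omega
    have ℓ_le : ℓ ≤ D * ℓ ^ 2 := by nlinarith
    have D_le : D ≤ D * ℓ ^ 2 := Nat.le_mul_of_pos_right _ (by positivity)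
    have Dℓ_le : D * ℓ ≤ D * ℓ ^ 2 := by gcongr; nlinarith
    have rows_le := Nat.mul_le_mul_left S.rows (D_pos.trans_le D_le)
    have cells_le := Nat.mul_le_mul_left (8 * S.rows) Dℓ_le
    have columns_le := Nat.mul_le_mul_left (S.rows * D * 8) width_le
    nlinarith
  have ℓ_le : ℓ ≤ (g + 25) * (φ.n + 1) ^ 4 := by
    have width_le := width_lt (g := g) φ.n
    have clauses_le := length_flatMap_clauseCode_le φ
    have n_le : φ.n + 1 ≤ (φ.n + 1) ^ 4 := Nat.le_self_pow four_ne_zero _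
    have g_le : g ≤ g * (φ.n + 1) ^ 4 := Nat.le_mul_of_pos_right _ (by positivity)
    linarith
  calc _ ≤ 20 * (S.rows + 1) * D * ℓ ^ 2 := by linarith
    _ ≤ 20 * (S.rows + 1) * D * ((g + 25) * (φ.n + 1) ^ 4) ^ 2 := by gcongr
    _ = _ := by ring

theorem decidesInTime_satisfiable [NeZero g] {T : GridTilingInstance → ℝ}
    {M : TM2ComputableAux Bool Bool}
    (hM : DecidesInTime GridTilingInstance.encode GridTilingInstance.MonotoneSolvable T M) :
    DecidesInTime ThreeCNF.encode ThreeCNF.Satisfiable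
      (fun φ => S.writingTime φ.n + T (S.grid φ)) (composeReversed S.writer M) :=
  (DecidesInTime.of_reduction monotoneSolvable_grid_iff outputsWithin_writer hM).mono fun φ => by
    have := le_writingTime (S := S) φ
    gcongr
    exact_mod_cast this

theorem two_pow_numDigits_le [NeZero g] {η : ℝ} (hη : 3 / g ≤ η) (n : ℕ) :
    (2 : ℝ) ^ numDigits g n ≤ 8 * (2 : ℝ) ^ (η * n) := by
  have g_pos : (0 : ℝ) < g := Nat.cast_pos.2 (NeZero.pos g)
  have width_le : (g : ℝ) * (n ⌈/⌉ g : ℕ) ≤ n + g := by exact_mod_cast (width_lt n).le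
  have numDigits_le : (numDigits g n : ℝ) ≤ 3 + η * n := by
    calc (numDigits g n : ℝ) = 3 / g * (g * (n ⌈/⌉ g : ℕ)) := by
          rw [numDigits]
          push_cast
          field_simp
      _ ≤ 3 / g * (n + g) := by gcongr
      _ = 3 + 3 / g * n := by field_simp; ring
      _ ≤ 3 + η * n := by gcongr
  rw [← Real.rpow_natCast]
  calc (2 : ℝ) ^ (numDigits g n : ℝ) ≤ (2 : ℝ) ^ (3 + η * n) :=
        Real.rpow_le_rpow_of_exponent_le one_le_two numDigits_le
    _ = 8 * (2 : ℝ) ^ (η * n) := by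
        rw [Real.rpow_add two_pos]
        norm_num

end RowScheme

theorem exists_pow_le_const_mul_two_rpow (k : ℕ) {η : ℝ} (hη : 0 < η) :
    ∃ K : ℝ, ∀ n : ℕ, ((n : ℝ) + 1) ^ k ≤ K * (2 : ℝ) ^ (η * n) := by
  obtain ⟨K, hK⟩ := (tendsto_pow_const_div_const_pow_of_one_lt k
    (Real.one_lt_rpow one_lt_two hη)).bddAbove_range
  refine ⟨K * (2 : ℝ) ^ η, fun n => ?_⟩
  have bound := (div_le_iff₀ (by positivity)).1 (hK ⟨n + 1, rfl⟩)
  push_cast at bound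
  rwa [pow_succ', ← mul_assoc, ← Real.rpow_mul_natCast zero_le_two] at bound

namespace RowScheme

variable {g : ℕ} [NeZero g] (S : RowScheme g) {δ : ℝ}

theorem exists_writingTime_le (hδ : 0 < δ) (hg : 3 / g ≤ δ / 4) :
    ∃ K : ℝ, ∀ n : ℕ, (S.writingTime n : ℝ) ≤ K * (2 : ℝ) ^ (δ * n) := by
  obtain ⟨K, hK⟩ := exists_pow_le_const_mul_two_rpow 8 (show 0 < δ - δ / 4 by linarith)
  refine ⟨20 * (S.rows + 1) * (g + 25) ^ 2 * (8 * K), fun n => ?_⟩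
  calc (S.writingTime n : ℝ)
      = 20 * (S.rows + 1) * (g + 25) ^ 2 * (2 ^ numDigits g n * (n + 1) ^ 8) := by
        simp [writingTime]
    _ ≤ 20 * (S.rows + 1) * (g + 25) ^ 2 *
          (8 * (2 : ℝ) ^ (δ / 4 * n) * (K * (2 : ℝ) ^ ((δ - δ / 4) * n))) := by
        gcongr
        exacts [two_pow_numDigits_le hg n, hK n]
    _ = 20 * (S.rows + 1) * (g + 25) ^ 2 * (8 * K) *
          ((2 : ℝ) ^ (δ / 4 * n) * (2 : ℝ) ^ ((δ - δ / 4) * n)) := by ring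
    _ = 20 * (S.rows + 1) * (g + 25) ^ 2 * (8 * K) * (2 : ℝ) ^ (δ * n) := by
        rw [← Real.rpow_add two_pos]
        ring_nf

theorem two_rpow_area_le (hδ : 0 < δ) (φ : ThreeCNF) :
    (2 : ℝ) ^ (δ / (4 * S.rows) * ((S.grid φ).x * (S.grid φ).y)) ≤
      (2 : ℝ) ^ (δ / 4 * (2 * g + 1)) * (2 : ℝ) ^ (δ / 2 * φ.n) := by
  have rows_pos : (0 : ℝ) < S.rows := Nat.cast_pos.2 (NeZero.pos S.rows)
  have width_le : (width g φ.n : ℝ) ≤ φ.n + g := by exact_mod_cast (width_lt φ.n).le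
  rw [← Real.rpow_add two_pos]
  refine Real.rpow_le_rpow_of_exponent_le one_le_two ?_
  calc δ / (4 * S.rows) * ((S.grid φ).x * (S.grid φ).y)
      = δ / 4 * (2 * width g φ.n + 1) := by
        simp only [grid]
        push_cast
        field_simp
    _ ≤ δ / 4 * (2 * (φ.n + g) + 1) := by gcongr
    _ = δ / 4 * (2 * g + 1) + δ / 2 * φ.n := by ring

theorem rpow_N_le {b : ℝ} (hb : 0 < b) (hg : 3 / g ≤ δ / (4 * b)) (φ : ThreeCNF) :
    ((S.grid φ).N : ℝ) ^ b ≤ 16 ^ b * (2 : ℝ) ^ (δ / 4 * φ.n) := by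
  have N_le : ((S.grid φ).N : ℝ) ≤ 16 * (2 : ℝ) ^ (δ / (4 * b) * φ.n) := by
    simp only [grid]
    push_cast
    linarith [two_pow_numDigits_le hg φ.n]
  calc ((S.grid φ).N : ℝ) ^ b ≤ (16 * (2 : ℝ) ^ (δ / (4 * b) * φ.n)) ^ b := by gcongr
    _ = 16 ^ b * (2 : ℝ) ^ (δ / 4 * φ.n) := by
        rw [Real.mul_rpow (by positivity) (by positivity), ← Real.rpow_mul zero_le_two]
        congr 2
        field_simp

theorem exists_tilingTime_le {b : ℝ} (hδ : 0 < δ) (hb : 0 < b) (hg : 3 / g ≤ δ / (4 * b)) :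
    ∃ K : ℝ, ∀ φ : ThreeCNF,
      (2 : ℝ) ^ (δ / (4 * S.rows) * ((S.grid φ).x * (S.grid φ).y)) * (S.grid φ).N ^ b ≤
        K * (2 : ℝ) ^ (δ * φ.n) := by
  refine ⟨(2 : ℝ) ^ (δ / 4 * (2 * g + 1)) * 16 ^ b, fun φ => ?_⟩
  calc _ ≤ ((2 : ℝ) ^ (δ / 4 * (2 * g + 1)) * (2 : ℝ) ^ (δ / 2 * φ.n)) *
          (16 ^ b * (2 : ℝ) ^ (δ / 4 * φ.n)) := by
        gcongr
        exacts [S.two_rpow_area_le hδ φ, S.rpow_N_le hb hg φ]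
    _ = (2 : ℝ) ^ (δ / 4 * (2 * g + 1)) * 16 ^ b * (2 : ℝ) ^ (δ / 2 * φ.n + δ / 4 * φ.n) := by
        rw [Real.rpow_add two_pos]
        ring
    _ ≤ (2 : ℝ) ^ (δ / 4 * (2 * g + 1)) * 16 ^ b * (2 : ℝ) ^ (δ * φ.n) := by
        gcongr
        exacts [one_le_two, by nlinarith [hδ, φ.n.cast_nonneg (α := ℝ)]]

end RowScheme

theorem mainTheorem11 (hETH : ExponentialTimeHypothesis) (b : ℝ) (hb : 0 < b) :
    ∃ ε : ℝ, 0 < ε ∧ ∀ C : ℝ, 0 < C →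
      ¬ ∃ M : Turing.TM2ComputableAux Bool Bool,
        DecidesInTime GridTilingInstance.encode GridTilingInstance.MonotoneSolvable
          (fun I => C * (2 : ℝ) ^ (ε * ((I.x : ℝ) * (I.y : ℝ))) * (I.N : ℝ) ^ b) M := by
  obtain ⟨δ, hδ, no_machine⟩ := hETH
  have small {η : ℝ} (hη : 0 < η) : ∀ᶠ g : ℕ in Filter.atTop, 3 / (g : ℝ) ≤ η :=
    (tendsto_const_div_atTop_nhds_zero_nat 3).eventually_le_const hη
  obtain ⟨g, hg, writing_small, tiling_small⟩ := ((Filter.eventually_ge_atTop 3).and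
    ((small (η := δ / 4) (by positivity)).and (small (η := δ / (4 * b)) (by positivity)))).exists
  have : NeZero g := ⟨by omega⟩
  obtain ⟨S⟩ := RowScheme.nonempty hg
  have rows_pos : (0 : ℝ) < S.rows := Nat.cast_pos.2 (NeZero.pos S.rows)
  refine ⟨δ / (4 * S.rows), by positivity, fun C hC ⟨M, hM⟩ => ?_⟩
  obtain ⟨K, writing_le⟩ := S.exists_writingTime_le hδ writing_small
  obtain ⟨K', tiling_le⟩ := S.exists_tilingTime_le hδ hb tiling_small
  refine no_machine ⟨K + C * K', composeReversed S.writer M,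
    (S.decidesInTime_satisfiable hM).mono fun φ => ?_⟩
  rw [add_mul, mul_assoc C, mul_assoc C]
  have tiling_le := tiling_le φ
  gcongr
  exact writing_le φ.n
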